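/- Let $k$ be a field of characteristic zero, let $m,n\geq 2$ be integers with greatest common divisor $d=(m,n)$, and let $q,\overline q\in k$ be primitive roots of unity of order $m$ and $n$ respectively. Write $U_d(k)=\{\sigma\in k \mid \sigma^d=1\}$. Let $T_{m^2}(q)$ be the Taft Hopf algebra generated by $h,x$ subject to $h^m=1$, $x^m=0$, $xh=q\,hx$, with $\Delta(h)=h\otimes h$, $\Delta(x)=x\otimes h+1\otimes x$, $\varepsilon(h)=1$, $\varepsilon(x)=0$, $S(h)=h^{-1}$, $S(x)=-xh^{-1}$, and let $\mathbb T_{n^2}(\overline q)$ be the Taft Hopf algebra for $(n,\overline q)$, with generators $H,X$. A Hopf algebra $E$ over $k$ factors through Hopf algebras $A$ and $L$ if there are injective Hopf algebra maps $i:A\to E$, $j:L\to E$ such that $A\otimes L\to E$, $a\otimes l\mapsto i(a)j(l)$, is bijective. For $\sigma\in U_d(k)$ let $\mathrm T^{\sigma}_{n,m}(\overline q,q)$ be the Hopf algebra generated by $h,x,H,X$ subject to $$h^m=H^n=1,\quad x^m=X^n=0,\quad xh=q\,hx,\quad XH=\overline q\,HX,$$ $$xH=\sigma Hx,\quad hX=\sigma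 Xh,\quad xX=\sigma Xx,\quad hH=Hh.$$ For $m=n$ and $\alpha\in k^*$ let $\mathrm Q^{\alpha}_n(q)$ be the Hopf algebra generated by $h,x,H,X$ subject to $$h^n=H^n=1,\quad x^n=X^n=0,\quad xh=q\,hx,\quad XH=q^{n-1}HX,$$ $$xH=q\,Hx,\quad hX=q\,Xh,\quad xX-q\,Xx=\alpha(1-Hh),\quad hH=Hh.$$ In both, $h,H$ are group-like, $\Delta(x)=x\otimes h+1\otimes x$, $\Delta(X)=X\otimes H+1\otimes X$, $\varepsilon(x)=\varepsilon(X)=0$, and the antipode is $S(h)=h^{m-1}$, $S(H)=H^{n-1}$, $S(x)=-q^{m-1}h^{m-1}x$, $S(X)=-\overline q^{\,n-1}H^{n-1}X$ (with $m=n$ and $\overline q=q^{n-1}$ for $\mathrm Q^{\alpha}_n(q)$). 1) If $m\neq n$ or $\overline q\neq q^{n-1}$, then a Hopf algebra $E$ over $k$ factors through $\mathbb T_{n^2}(\overline q)$ and $T_{m^2}(q)$ if and only if $E\cong \mathrm T^{\sigma}_{n,m}(\overline q,q)$ for some $\sigma\in U_d(k)$. 2) If $m=n$ and $\overline q=q^{n-1}$,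 then a Hopf algebra $E$ over $k$ factors through $\mathbb T_{n^2}(q^{n-1})$ and $T_{n^2}(q)$ if and only if $E\cong \mathrm T^{\sigma}_{n,n}(q^{n-1},q)$ for some $\sigma\in U_n(k)$ or $E\cong\mathrm Q^{\alpha}_n(q)$ for some $\alpha\in k^*$. -/

import Mathlib

open scoped TensorProduct

noncomputable section

namespace TaftBicrossed

/-! ### Nilpotency of a sum of two `q`-commuting nilpotent elements -/

/-- Gaussian binomial coefficients, through the `q`-Pascal recursion. -/
def qChoose {k : Type*} [Field k] (q : k) : ℕ → ℕ → k
  | _, 0 => 1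
  | 0, _ + 1 => 0
  | n + 1, j + 1 => qChoose q n j + q ^ (j + 1) * qChoose q n (j + 1)

theorem qChoose_zero_right {k : Type*} [Field k] (q : k) (n : ℕ) : qChoose q n 0 = 1 := by
  cases n <;> simp [qChoose]

theorem qChoose_eq_zero {k : Type*} [Field k] (q : k) (n : ℕ) :
    ∀ j, n < j → qChoose q n j = 0 := by
  induction n with
  | zero => intro j hj; obtain ⟨j, rfl⟩ := Nat.exists_eq_succ_of_ne_zero hj.ne'; simp [qChoose]
  | succ n ih =>
    intro j hj
    obtain ⟨j, rfl⟩ := Nat.exists_eq_succ_of_ne_zero (show j ≠ 0 by omega)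
    simp [qChoose, ih j (by omega), ih (j + 1) (by omega)]

theorem qChoose_rec {k : Type*} [Field k] (q : k) (n : ℕ) :
    ∀ j, q ^ j * (q ^ (j + 1) - 1) * qChoose q n (j + 1) = (q ^ n - q ^ j) * qChoose q n j := by
  induction n with
  | zero => intro j; cases j <;> simp [qChoose]
  | succ n ih =>
    intro j
    cases j with
    | zero =>
      have h := ih 0
      simp only [qChoose, qChoose_zero_right] at h ⊢
      linear_combination q * h
    | succ j =>
      have h0 := ih j
      have h1 := ih (j + 1)
      simp only [qChoose] at h0 h1 ⊢
      linear_combination q ^ (j + 2) * h1 + q * h0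

theorem qChoose_primitive {k : Type*} [Field k] {q : k} {m : ℕ} (hq : IsPrimitiveRoot q m) :
    ∀ j, j + 1 < m → qChoose q m (j + 1) = 0 := by
  intro j
  induction j with
  | zero =>
    intro hj
    have h := qChoose_rec q m 0
    have h1 : q ^ (0 + 1) - 1 ≠ 0 := sub_ne_zero.2 (hq.pow_ne_one_of_pos_of_lt (by omega) hj)
    rw [hq.pow_eq_one, pow_zero, sub_self, zero_mul, one_mul] at h
    exact (mul_eq_zero.1 h).resolve_left h1
  | succ j ih =>
    intro hj
    have h := qChoose_rec q m (j + 1)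
    have h1 : q ^ (j + 1 + 1) - 1 ≠ 0 := sub_ne_zero.2 (hq.pow_ne_one_of_pos_of_lt (by omega) hj)
    have h2 : q ^ (j + 1) ≠ 0 := pow_ne_zero _ (hq.ne_zero (by omega))
    rw [ih (by omega), mul_zero] at h
    exact (mul_eq_zero.1 h).resolve_left (mul_ne_zero h2 h1)

theorem mul_pow_of_qcomm {k B : Type*} [Field k] [Ring B] [Algebra k B] {q : k} {a b : B}
    (hba : b * a = q • (a * b)) (i : ℕ) : b * a ^ i = q ^ i • (a ^ i * b) := by
  induction i with
  | zero => simp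
  | succ i ih =>
    rw [pow_succ, ← mul_assoc, ih, smul_mul_assoc, mul_assoc, hba, mul_smul_comm, smul_smul,
      pow_succ, mul_assoc]

theorem add_pow_of_qcomm {k B : Type*} [Field k] [Ring B] [Algebra k B] {q : k} {a b : B}
    (hba : b * a = q • (a * b)) (n : ℕ) :
    (a + b) ^ n =
      ∑ p ∈ Finset.HasAntidiagonal.antidiagonal n, qChoose q n p.1 • (a ^ p.1 * b ^ p.2) := by
  induction n with
  | zero => simp [qChoose]
  | succ n ih =>
    have h2 : ∑ p ∈ Finset.HasAntidiagonal.antidiagonal n, (qChoose q n p.1 * q ^ p.1) • (a ^ p.1 * b ^ (p.2 + 1))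
        = ∑ p ∈ Finset.HasAntidiagonal.antidiagonal (n + 1), (qChoose q n p.1 * q ^ p.1) • (a ^ p.1 * b ^ p.2) := by
      rw [Finset.Nat.sum_antidiagonal_succ']
      simp [qChoose_eq_zero q n (n + 1) (by omega)]
    rw [pow_succ', ih, add_mul, Finset.mul_sum, Finset.mul_sum]
    have h3 : ∀ p ∈ Finset.HasAntidiagonal.antidiagonal n, b * qChoose q n p.1 • (a ^ p.1 * b ^ p.2) =
        (qChoose q n p.1 * q ^ p.1) • (a ^ p.1 * b ^ (p.2 + 1)) := by
      intro p _
      rw [mul_smul_comm, ← mul_assoc, mul_pow_of_qcomm hba, smul_mul_assoc, smul_smul, mul_assoc,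
        ← pow_succ']
    rw [Finset.sum_congr rfl h3, h2, Finset.Nat.sum_antidiagonal_succ,
      Finset.Nat.sum_antidiagonal_succ, add_left_comm, ← Finset.sum_add_distrib]
    congr 1
    · simp [qChoose_zero_right]
    · refine Finset.sum_congr rfl fun p _ => ?_
      rw [mul_smul_comm, ← mul_assoc, ← pow_succ', ← add_smul]
      simp only [qChoose]
      ring_nf

theorem add_pow_eq_zero_of_qcomm {k B : Type*} [Field k] [Ring B] [Algebra k B] {q : k} {m : ℕ}
    (hq : IsPrimitiveRoot q m) {a b : B} (hba : b * a = q • (a * b))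
    (ha : a ^ m = 0) (hb : b ^ m = 0) : (a + b) ^ m = 0 := by
  rw [add_pow_of_qcomm hba]
  refine Finset.sum_eq_zero fun p hp => ?_
  rw [Finset.HasAntidiagonal.mem_antidiagonal] at hp
  obtain ⟨i, j⟩ := p
  simp only at hp ⊢
  rcases Nat.eq_zero_or_pos i with rfl | hi
  · simp [show j = m by omega, hb]
  rcases Nat.eq_zero_or_pos j with rfl | hj
  · simp [show i = m by omega, ha]
  obtain ⟨i, rfl⟩ := Nat.exists_eq_succ_of_ne_zero hi.ne'
  rw [qChoose_primitive hq i (by omega), zero_smul]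

theorem mul_pow_eq_zero_of_qcomm {k B : Type*} [Field k] [Ring B] [Algebra k B] {q : k} {m : ℕ}
    {a b : B} (hba : b * a = q • (a * b)) (ha : a ^ m = 0) : (a * b) ^ m = 0 := by
  have key : ∀ i : ℕ, ∃ c : k, (a * b) ^ i = c • (a ^ i * b ^ i) := by
    intro i
    induction i with
    | zero => exact ⟨1, by simp⟩
    | succ i ih =>
      obtain ⟨c, hc⟩ := ih
      refine ⟨c * q ^ i, ?_⟩
      rw [pow_succ', hc, mul_smul_comm, mul_assoc, ← mul_assoc b, mul_pow_of_qcomm hba,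
        smul_mul_assoc, mul_smul_comm, smul_smul, pow_succ' a, pow_succ' b]
      simp only [mul_assoc]
  obtain ⟨c, hc⟩ := key m
  rw [hc, ha, zero_mul, smul_zero]

/-! ### The antipode axioms may be checked on algebra generators -/

theorem antipode_left_of_adjoin {k A : Type*} [Field k] [Ring A] [Bialgebra k A]
    (S : A →ₗ[k] A) (hS1 : S 1 = 1) (hS : ∀ a b, S (a * b) = S b * S a)
    {s : Set A} (hs : Algebra.adjoin k s = ⊤)
    (h : ∀ a ∈ s, LinearMap.mul' k A (S.rTensor A (Coalgebra.comul a)) =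
      algebraMap k A (Coalgebra.counit a)) :
    LinearMap.mul' k A ∘ₗ S.rTensor A ∘ₗ Coalgebra.comul =
      Algebra.linearMap k A ∘ₗ Coalgebra.counit := by
  have key : ∀ t u : A ⊗[k] A, ∀ c : k, LinearMap.mul' k A (S.rTensor A t) = algebraMap k A c →
      LinearMap.mul' k A (S.rTensor A (t * u)) =
        algebraMap k A c * LinearMap.mul' k A (S.rTensor A u) := by
    intro t u c ht
    induction u using TensorProduct.induction_on with
    | zero => simp
    | add u v hu hv => simp only [mul_add, map_add, hu, hv]
    | tmul b b' =>
      have : ∀ t : A ⊗[k] A, LinearMap.mul' k A (S.rTensor A (t * b ⊗ₜ b')) =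
          S b * LinearMap.mul' k A (S.rTensor A t) * b' := by
        intro t
        induction t using TensorProduct.induction_on with
        | zero => simp
        | add u v hu hv => simp only [add_mul, mul_add, map_add, hu, hv]
        | tmul c c' => simp [hS, mul_assoc]
      rw [this, ht, ← Algebra.commutes]
      simp [mul_assoc]
  ext a
  have ha : a ∈ Algebra.adjoin k s := hs ▸ Algebra.mem_top
  induction ha using Algebra.adjoin_induction with
  | mem x hx => exact h x hx
  | algebraMap r =>
    simp [Algebra.algebraMap_eq_smul_one, Algebra.TensorProduct.one_def, hS1]
  | add x y _ _ hx hy => rw [map_add, map_add, hx, hy]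
  | mul x y _ _ hx hy =>
    simp only [LinearMap.comp_apply, Algebra.linearMap_apply, Bialgebra.comul_mul,
      Bialgebra.counit_mul, map_mul] at hx hy ⊢
    rw [key _ _ _ hx, hy]

theorem antipode_right_of_adjoin {k A : Type*} [Field k] [Ring A] [Bialgebra k A]
    (S : A →ₗ[k] A) (hS1 : S 1 = 1) (hS : ∀ a b, S (a * b) = S b * S a)
    {s : Set A} (hs : Algebra.adjoin k s = ⊤)
    (h : ∀ a ∈ s, LinearMap.mul' k A (S.lTensor A (Coalgebra.comul a)) =
      algebraMap k A (Coalgebra.counit a)) :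
    LinearMap.mul' k A ∘ₗ S.lTensor A ∘ₗ Coalgebra.comul =
      Algebra.linearMap k A ∘ₗ Coalgebra.counit := by
  have key : ∀ t u : A ⊗[k] A, ∀ c : k, LinearMap.mul' k A (S.lTensor A u) = algebraMap k A c →
      LinearMap.mul' k A (S.lTensor A (t * u)) =
        LinearMap.mul' k A (S.lTensor A t) * algebraMap k A c := by
    intro t u c hu
    induction t using TensorProduct.induction_on with
    | zero => simp
    | add u v hu hv => simp only [add_mul, map_add, hu, hv]
    | tmul b b' =>
      have : ∀ u : A ⊗[k] A, LinearMap.mul' k A (S.lTensor A (b ⊗ₜ b' * u)) =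
          b * LinearMap.mul' k A (S.lTensor A u) * S b' := by
        intro t
        induction t using TensorProduct.induction_on with
        | zero => simp
        | add u v hu hv => simp only [add_mul, mul_add, map_add, hu, hv]
        | tmul c c' => simp [hS, mul_assoc]
      rw [this, hu, mul_assoc, Algebra.commutes]
      simp [mul_assoc]
  ext a
  have ha : a ∈ Algebra.adjoin k s := hs ▸ Algebra.mem_top
  induction ha using Algebra.adjoin_induction with
  | mem x hx => exact h x hx
  | algebraMap r =>
    simp [Algebra.algebraMap_eq_smul_one, Algebra.TensorProduct.one_def, hS1]
  | add x y _ _ hx hy => rw [map_add, map_add, hx, hy]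
  | mul x y _ _ hx hy =>
    simp only [LinearMap.comp_apply, Algebra.linearMap_apply, Bialgebra.comul_mul,
      Bialgebra.counit_mul, map_mul] at hx hy ⊢
    rw [key _ _ _ hy, hx]

theorem adjoin_ringQuot {k G : Type*} [Field k]
    (r : FreeAlgebra k G → FreeAlgebra k G → Prop) :
    Algebra.adjoin k (Set.range fun g : G => RingQuot.mkAlgHom k r (FreeAlgebra.ι k g)) = ⊤ := by
  have h := congrArg (Subalgebra.map (RingQuot.mkAlgHom k r)) (FreeAlgebra.adjoin_range_ι k G)
  rw [AlgHom.map_adjoin, ← Set.range_comp, Algebra.map_top,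
    (AlgHom.range_eq_top _).2 (RingQuot.mkAlgHom_surjective k r)] at h
  exact h

/-! ### The Taft algebra -/

section Taft

/-- The two generators of a Taft algebra. -/
inductive TaftGen
  | h
  | x

/-- The defining relations `h ^ m = 1`, `x ^ m = 0`, `x h = q h x` of the Taft algebra. -/
inductive TaftRel {k : Type*} [Field k] (m : ℕ) (q : k) :
    FreeAlgebra k TaftGen → FreeAlgebra k TaftGen → Prop
  | h_pow : TaftRel m q (FreeAlgebra.ι k .h ^ m) 1
  | x_pow : TaftRel m q (FreeAlgebra.ι k .x ^ m) 0
  | x_mul_h : TaftRel m q (FreeAlgebra.ι k .x * FreeAlgebra.ι k .h)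
      (q • (FreeAlgebra.ι k .h * FreeAlgebra.ι k .x))

/-- The Taft algebra `T_{m²}(q)` for a primitive `m`-th root of unity `q`: the `k`-algebra generated
by `h` and `x` subject to `h ^ m = 1`, `x ^ m = 0`, `x h = q h x`. Its Hopf algebra structure
(`h` group-like, `x` an `(h, 1)`-primitive element) is the instance given below. -/
def Taft {k : Type*} [Field k] {m : ℕ} {q : k} (_hq : IsPrimitiveRoot q m) : Type _ :=
  RingQuot (TaftRel m q)

namespace Taft

variable {k : Type*} [Field k] {m : ℕ} {q : k} (hq : IsPrimitiveRoot q m)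

instance : Ring (Taft hq) := inferInstanceAs (Ring (RingQuot (TaftRel m q)))

instance : Algebra k (Taft hq) := inferInstanceAs (Algebra k (RingQuot (TaftRel m q)))

/-- The class of a generator in the Taft algebra. -/
def gen (g : TaftGen) : Taft hq := RingQuot.mkAlgHom k (TaftRel m q) (FreeAlgebra.ι k g)

/-- The generator `h`. -/
def h : Taft hq := gen hq .h

/-- The generator `x`. -/
def x : Taft hq := gen hq .x

theorem h_pow : h hq ^ m = 1 := by
  have := RingQuot.mkAlgHom_rel k (TaftRel.h_pow (m := m) (q := q))
  rw [map_pow, map_one] at this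
  exact this

theorem x_pow : x hq ^ m = 0 := by
  have := RingQuot.mkAlgHom_rel k (TaftRel.x_pow (m := m) (q := q))
  rw [map_pow, map_zero] at this
  exact this

theorem x_mul_h : x hq * h hq = q • (h hq * x hq) := by
  have := RingQuot.mkAlgHom_rel k (TaftRel.x_mul_h (m := m) (q := q))
  rw [map_smul, map_mul, map_mul] at this
  exact this

/-- The universal property of the Taft algebra. -/
def lift {B : Type*} [Ring B] [Algebra k B] (a b : B) (h1 : a ^ m = 1) (h2 : b ^ m = 0)
    (h3 : b * a = q • (a * b)) : Taft hq →ₐ[k] B :=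
  RingQuot.liftAlgHom k ⟨FreeAlgebra.lift k (fun g => TaftGen.casesOn g a b), by
    intro u v huv
    cases huv <;> simpa⟩

@[simp]
theorem lift_h {B : Type*} [Ring B] [Algebra k B] (a b : B) (h1 : a ^ m = 1) (h2 : b ^ m = 0)
    (h3 : b * a = q • (a * b)) : lift hq a b h1 h2 h3 (h hq) = a :=
  (RingQuot.liftAlgHom_mkAlgHom_apply _ _ _ _).trans (by simp)

@[simp]
theorem lift_x {B : Type*} [Ring B] [Algebra k B] (a b : B) (h1 : a ^ m = 1) (h2 : b ^ m = 0)
    (h3 : b * a = q • (a * b)) : lift hq a b h1 h2 h3 (x hq) = b :=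
  (RingQuot.liftAlgHom_mkAlgHom_apply _ _ _ _).trans (by simp)

theorem adjoin_gen : Algebra.adjoin k (Set.range (gen hq)) = ⊤ :=
  adjoin_ringQuot (TaftRel m q)

theorem algHom_ext {B : Type*} [Semiring B] [Algebra k B] {f g : Taft hq →ₐ[k] B}
    (hh : f (h hq) = g (h hq)) (hx : f (x hq) = g (x hq)) : f = g := by
  refine AlgHom.ext_of_adjoin_eq_top (adjoin_gen hq) ?_
  rintro _ ⟨_ | _, rfl⟩
  exacts [hh, hx]

/-- The comultiplication: `Δ h = h ⊗ h` and `Δ x = x ⊗ h + 1 ⊗ x`. -/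
def comulHom : Taft hq →ₐ[k] Taft hq ⊗[k] Taft hq :=
  lift hq (h hq ⊗ₜ h hq) (x hq ⊗ₜ h hq + 1 ⊗ₜ x hq)
    (by rw [Algebra.TensorProduct.tmul_pow, h_pow, Algebra.TensorProduct.one_def])
    (add_pow_eq_zero_of_qcomm hq
      (by simp [Algebra.TensorProduct.tmul_mul_tmul, x_mul_h])
      (by simp [Algebra.TensorProduct.tmul_pow, x_pow])
      (by simp [Algebra.TensorProduct.tmul_pow, x_pow]))
    (by simp [Algebra.TensorProduct.tmul_mul_tmul, x_mul_h, add_mul, mul_add,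
          TensorProduct.smul_tmul'])

variable [NeZero m]

/-- The counit: `ε h = 1` and `ε x = 0`. -/
def counitHom : Taft hq →ₐ[k] k :=
  lift hq 1 0 (one_pow m) (zero_pow (NeZero.ne m)) (by simp)

instance : Bialgebra k (Taft hq) :=
  Bialgebra.ofAlgHom (comulHom hq) (counitHom hq)
    (by apply algHom_ext <;>
      simp [comulHom, TensorProduct.add_tmul, TensorProduct.tmul_add,
        Algebra.TensorProduct.one_def, add_assoc])
    (by apply algHom_ext <;> simp [comulHom, counitHom])
    (by apply algHom_ext <;> simp [comulHom, counitHom])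

theorem comul_h : Coalgebra.comul (R := k) (h hq) = h hq ⊗ₜ h hq :=
  lift_h hq _ _ _ _ _

theorem comul_x : Coalgebra.comul (R := k) (x hq) = x hq ⊗ₜ h hq + 1 ⊗ₜ x hq :=
  lift_x hq _ _ _ _ _

theorem counit_h : Coalgebra.counit (R := k) (h hq) = 1 :=
  lift_h hq _ _ _ _ _

theorem counit_x : Coalgebra.counit (R := k) (x hq) = 0 :=
  lift_x hq _ _ _ _ _

theorem h_mul_pow : h hq * h hq ^ (m - 1) = 1 := by
  rw [← pow_succ', Nat.sub_add_cancel (NeZero.one_le), h_pow]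

theorem h_pow_mul : h hq ^ (m - 1) * h hq = 1 := by
  rw [← pow_succ, Nat.sub_add_cancel (NeZero.one_le), h_pow]

theorem hinv_mul_x : h hq ^ (m - 1) * x hq = q • (x hq * h hq ^ (m - 1)) := by
  calc h hq ^ (m - 1) * x hq = h hq ^ (m - 1) * (x hq * h hq) * h hq ^ (m - 1) := by
        rw [mul_assoc, mul_assoc, h_mul_pow, mul_one]
    _ = q • (x hq * h hq ^ (m - 1)) := by
        rw [x_mul_h, mul_smul_comm, ← mul_assoc, h_pow_mul, one_mul, smul_mul_assoc]

/-- The antipode as a homomorphism to the opposite algebra: `S h = h⁻¹ = h ^ (m - 1)` and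
`S x = - x h⁻¹`. -/
def antipodeHom : Taft hq →ₐ[k] (Taft hq)ᵐᵒᵖ :=
  lift hq (MulOpposite.op (h hq ^ (m - 1))) (MulOpposite.op (-(x hq * h hq ^ (m - 1))))
    (by rw [← MulOpposite.op_pow, ← pow_mul, mul_comm, pow_mul, h_pow, one_pow,
      MulOpposite.op_one])
    (by
      rw [← MulOpposite.op_pow, neg_pow, mul_pow_eq_zero_of_qcomm (hinv_mul_x hq) (x_pow hq),
        mul_zero, MulOpposite.op_zero])
    (by
      rw [← MulOpposite.op_mul, ← MulOpposite.op_mul, ← MulOpposite.op_smul, mul_neg, neg_mul,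
        ← mul_assoc, hinv_mul_x, smul_neg, smul_mul_assoc])

instance : HopfAlgebra k (Taft hq) where
  antipode := (MulOpposite.opLinearEquiv k).symm.toLinearMap ∘ₗ (antipodeHom hq).toLinearMap
  mul_antipode_rTensor_comul := by
    refine antipode_left_of_adjoin _ (by simp) (by simp) (adjoin_gen hq) ?_
    rintro _ ⟨_ | _, rfl⟩
    · change LinearMap.mul' k _ (LinearMap.rTensor _ _ (Coalgebra.comul (h hq))) =
        algebraMap k _ (Coalgebra.counit (h hq))
      rw [comul_h, counit_h]
      simp [antipodeHom, h_pow_mul]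
    · change LinearMap.mul' k _ (LinearMap.rTensor _ _ (Coalgebra.comul (x hq))) =
        algebraMap k _ (Coalgebra.counit (x hq))
      rw [comul_x, counit_x]
      simp [antipodeHom, h_pow_mul, mul_assoc]
  mul_antipode_lTensor_comul := by
    refine antipode_right_of_adjoin _ (by simp) (by simp) (adjoin_gen hq) ?_
    rintro _ ⟨_ | _, rfl⟩
    · change LinearMap.mul' k _ (LinearMap.lTensor _ _ (Coalgebra.comul (h hq))) =
        algebraMap k _ (Coalgebra.counit (h hq))
      rw [comul_h, counit_h]
      simp [antipodeHom, h_mul_pow]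
    · change LinearMap.mul' k _ (LinearMap.lTensor _ _ (Coalgebra.comul (x hq))) =
        algebraMap k _ (Coalgebra.counit (x hq))
      rw [comul_x, counit_x]
      simp [antipodeHom]

theorem antipode_h : HopfAlgebra.antipode k (h hq) = h hq ^ (m - 1) := by
  change MulOpposite.unop (antipodeHom hq (h hq)) = _
  simp [antipodeHom]

theorem antipode_x : HopfAlgebra.antipode k (x hq) = -(x hq * h hq ^ (m - 1)) := by
  change MulOpposite.unop (antipodeHom hq (x hq)) = _
  simp [antipodeHom]

end Taft

end Taft

/-! ### The Hopf algebras generated by two Taft algebras -/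

section TwoTaft

/-- The generators `h`, `x`, `H`, `X`. -/
inductive TwoTaftGen
  | h
  | x
  | H
  | X

/-- Four elements `h`, `x`, `H`, `X` of a `k`-algebra satisfy the relations
`h ^ m = H ^ n = 1`, `x ^ m = X ^ n = 0`, `x h = q h x`, `X H = q' H X`,
`x H = σ H x`, `h X = σ X h`, `x X - σ X x = α (1 - H h)`, `h H = H h`. -/
structure TwoTaftRelations {k B : Type*} [Field k] [Ring B] [Algebra k B] (m n : ℕ)
    (q q' σ α : k) (h x H X : B) : Prop where
  h_pow : h ^ m = 1
  H_pow : H ^ n = 1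
  x_pow : x ^ m = 0
  X_pow : X ^ n = 0
  x_mul_h : x * h = q • (h * x)
  X_mul_H : X * H = q' • (H * X)
  x_mul_H : x * H = σ • (H * x)
  h_mul_X : h * X = σ • (X * h)
  x_mul_X : x * X - σ • (X * x) = α • (1 - H * h)
  h_mul_H : h * H = H * h

open FreeAlgebra in
/-- The relations of `TwoTaftRelations`, imposed on the generators of a free algebra. -/
inductive TwoTaftRel {k : Type*} [Field k] (m n : ℕ) (q q' σ α : k) :
    FreeAlgebra k TwoTaftGen → FreeAlgebra k TwoTaftGen → Prop
  | h_pow : TwoTaftRel m n q q' σ α (ι k .h ^ m) 1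
  | H_pow : TwoTaftRel m n q q' σ α (ι k .H ^ n) 1
  | x_pow : TwoTaftRel m n q q' σ α (ι k .x ^ m) 0
  | X_pow : TwoTaftRel m n q q' σ α (ι k .X ^ n) 0
  | x_mul_h : TwoTaftRel m n q q' σ α (ι k .x * ι k .h) (q • (ι k .h * ι k .x))
  | X_mul_H : TwoTaftRel m n q q' σ α (ι k .X * ι k .H) (q' • (ι k .H * ι k .X))
  | x_mul_H : TwoTaftRel m n q q' σ α (ι k .x * ι k .H) (σ • (ι k .H * ι k .x))
  | h_mul_X : TwoTaftRel m n q q' σ α (ι k .h * ι k .X) (σ • (ι k .X * ι k .h))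
  | x_mul_X : TwoTaftRel m n q q' σ α (ι k .x * ι k .X - σ • (ι k .X * ι k .x))
      (α • (1 - ι k .H * ι k .h))
  | h_mul_H : TwoTaftRel m n q q' σ α (ι k .h * ι k .H) (ι k .H * ι k .h)

/-- The `k`-algebra generated by `h`, `x`, `H`, `X` subject to the relations `TwoTaftRelations`,
where `q` is a primitive `m`-th and `q'` a primitive `n`-th root of unity. It is a Hopf algebra, by
the instance given below, with `h`, `H` group-like, `x` an `(h, 1)`-primitive and `X` an
`(H, 1)`-primitive element. The two families `TaftSigma` and `TaftQ` are special cases. -/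
def TwoTaft {k : Type*} [Field k] {m n : ℕ} {q q' : k} (_hq' : IsPrimitiveRoot q' n)
    (_hq : IsPrimitiveRoot q m) (σ α : k) : Type _ :=
  RingQuot (TwoTaftRel m n q q' σ α)

namespace TwoTaft

variable {k : Type*} [Field k] {m n : ℕ} {q q' : k} (hq' : IsPrimitiveRoot q' n)
  (hq : IsPrimitiveRoot q m) (σ α : k)

instance : Ring (TwoTaft hq' hq σ α) :=
  inferInstanceAs (Ring (RingQuot (TwoTaftRel m n q q' σ α)))

instance : Algebra k (TwoTaft hq' hq σ α) :=
  inferInstanceAs (Algebra k (RingQuot (TwoTaftRel m n q q' σ α)))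

/-- The class of a generator. -/
def gen (g : TwoTaftGen) : TwoTaft hq' hq σ α :=
  RingQuot.mkAlgHom k (TwoTaftRel m n q q' σ α) (FreeAlgebra.ι k g)

/-- The generator `h`. -/
def h : TwoTaft hq' hq σ α := gen hq' hq σ α .h

/-- The generator `x`. -/
def x : TwoTaft hq' hq σ α := gen hq' hq σ α .x

/-- The generator `H`. -/
def H : TwoTaft hq' hq σ α := gen hq' hq σ α .H

/-- The generator `X`. -/
def X : TwoTaft hq' hq σ α := gen hq' hq σ α .X

theorem relations : TwoTaftRelations m n q q' σ α (h hq' hq σ α) (x hq' hq σ α) (H hq' hq σ α)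
    (X hq' hq σ α) where
  h_pow := by
    have := RingQuot.mkAlgHom_rel k (TwoTaftRel.h_pow (m := m) (n := n) (q := q) (q' := q')
      (σ := σ) (α := α))
    simp only [map_pow, map_one] at this
    exact this
  H_pow := by
    have := RingQuot.mkAlgHom_rel k (TwoTaftRel.H_pow (m := m) (n := n) (q := q) (q' := q')
      (σ := σ) (α := α))
    simp only [map_pow, map_one] at this
    exact this
  x_pow := by
    have := RingQuot.mkAlgHom_rel k (TwoTaftRel.x_pow (m := m) (n := n) (q := q) (q' := q')
      (σ := σ) (α := α))
    simp only [map_pow, map_zero] at this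
    exact this
  X_pow := by
    have := RingQuot.mkAlgHom_rel k (TwoTaftRel.X_pow (m := m) (n := n) (q := q) (q' := q')
      (σ := σ) (α := α))
    simp only [map_pow, map_zero] at this
    exact this
  x_mul_h := by
    have := RingQuot.mkAlgHom_rel k (TwoTaftRel.x_mul_h (m := m) (n := n) (q := q) (q' := q')
      (σ := σ) (α := α))
    simp only [map_smul, map_mul] at this
    exact this
  X_mul_H := by
    have := RingQuot.mkAlgHom_rel k (TwoTaftRel.X_mul_H (m := m) (n := n) (q := q) (q' := q')
      (σ := σ) (α := α))
    simp only [map_smul, map_mul] at this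
    exact this
  x_mul_H := by
    have := RingQuot.mkAlgHom_rel k (TwoTaftRel.x_mul_H (m := m) (n := n) (q := q) (q' := q')
      (σ := σ) (α := α))
    simp only [map_smul, map_mul] at this
    exact this
  h_mul_X := by
    have := RingQuot.mkAlgHom_rel k (TwoTaftRel.h_mul_X (m := m) (n := n) (q := q) (q' := q')
      (σ := σ) (α := α))
    simp only [map_smul, map_mul] at this
    exact this
  x_mul_X := by
    have := RingQuot.mkAlgHom_rel k (TwoTaftRel.x_mul_X (m := m) (n := n) (q := q) (q' := q')
      (σ := σ) (α := α))
    simp only [map_smul, map_mul, map_sub, map_one] at this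
    exact this
  h_mul_H := by
    have := RingQuot.mkAlgHom_rel k (TwoTaftRel.h_mul_H (m := m) (n := n) (q := q) (q' := q')
      (σ := σ) (α := α))
    simp only [map_mul] at this
    exact this

/-- The universal property of the presentation. -/
def lift {B : Type*} [Ring B] [Algebra k B] {a b c d : B}
    (w : TwoTaftRelations m n q q' σ α a b c d) : TwoTaft hq' hq σ α →ₐ[k] B :=
  RingQuot.liftAlgHom k ⟨FreeAlgebra.lift k (fun g => TwoTaftGen.casesOn g a b c d), by
    intro u v huv
    cases huv
    · simpa using w.h_pow
    · simpa using w.H_pow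
    · simpa using w.x_pow
    · simpa using w.X_pow
    · simpa using w.x_mul_h
    · simpa using w.X_mul_H
    · simpa using w.x_mul_H
    · simpa using w.h_mul_X
    · simpa using w.x_mul_X
    · simpa using w.h_mul_H⟩

section lift

variable {B : Type*} [Ring B] [Algebra k B] {a b c d : B}
  (w : TwoTaftRelations m n q q' σ α a b c d)

@[simp]
theorem lift_h : lift hq' hq σ α w (h hq' hq σ α) = a :=
  (RingQuot.liftAlgHom_mkAlgHom_apply _ _ _ _).trans (by simp)

@[simp]
theorem lift_x : lift hq' hq σ α w (x hq' hq σ α) = b :=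
  (RingQuot.liftAlgHom_mkAlgHom_apply _ _ _ _).trans (by simp)

@[simp]
theorem lift_H : lift hq' hq σ α w (H hq' hq σ α) = c :=
  (RingQuot.liftAlgHom_mkAlgHom_apply _ _ _ _).trans (by simp)

@[simp]
theorem lift_X : lift hq' hq σ α w (X hq' hq σ α) = d :=
  (RingQuot.liftAlgHom_mkAlgHom_apply _ _ _ _).trans (by simp)

end lift

theorem adjoin_gen : Algebra.adjoin k (Set.range (gen hq' hq σ α)) = ⊤ :=
  adjoin_ringQuot (TwoTaftRel m n q q' σ α)

theorem algHom_ext {B : Type*} [Semiring B] [Algebra k B] {f g : TwoTaft hq' hq σ α →ₐ[k] B}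
    (hh : f (h hq' hq σ α) = g (h hq' hq σ α)) (hx : f (x hq' hq σ α) = g (x hq' hq σ α))
    (hH : f (H hq' hq σ α) = g (H hq' hq σ α)) (hX : f (X hq' hq σ α) = g (X hq' hq σ α)) :
    f = g := by
  refine AlgHom.ext_of_adjoin_eq_top (adjoin_gen hq' hq σ α) ?_
  rintro _ ⟨_ | _ | _ | _, rfl⟩
  exacts [hh, hx, hH, hX]

/-- The relations are compatible with the comultiplication. -/
theorem _root_.TaftBicrossed.TwoTaftRelations.comul {k B : Type*} [Field k] [Ring B] [Algebra k B]
    {m n : ℕ} {q q' σ α : k} (hq' : IsPrimitiveRoot q' n) (hq : IsPrimitiveRoot q m)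
    {h x H X : B} (w : TwoTaftRelations m n q q' σ α h x H X) :
    TwoTaftRelations m n q q' σ α (h ⊗ₜ[k] h) (x ⊗ₜ[k] h + 1 ⊗ₜ[k] x) (H ⊗ₜ[k] H)
      (X ⊗ₜ[k] H + 1 ⊗ₜ[k] X) where
  h_pow := by rw [Algebra.TensorProduct.tmul_pow, w.h_pow, Algebra.TensorProduct.one_def]
  H_pow := by rw [Algebra.TensorProduct.tmul_pow, w.H_pow, Algebra.TensorProduct.one_def]
  x_pow := add_pow_eq_zero_of_qcomm hq
    (by simp [Algebra.TensorProduct.tmul_mul_tmul, w.x_mul_h])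
    (by simp [Algebra.TensorProduct.tmul_pow, w.x_pow])
    (by simp [Algebra.TensorProduct.tmul_pow, w.x_pow])
  X_pow := add_pow_eq_zero_of_qcomm hq'
    (by simp [Algebra.TensorProduct.tmul_mul_tmul, w.X_mul_H])
    (by simp [Algebra.TensorProduct.tmul_pow, w.X_pow])
    (by simp [Algebra.TensorProduct.tmul_pow, w.X_pow])
  x_mul_h := by
    simp [Algebra.TensorProduct.tmul_mul_tmul, w.x_mul_h, add_mul, mul_add,
      TensorProduct.smul_tmul']
  X_mul_H := by
    simp [Algebra.TensorProduct.tmul_mul_tmul, w.X_mul_H, add_mul, mul_add,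
      TensorProduct.smul_tmul']
  x_mul_H := by
    simp [Algebra.TensorProduct.tmul_mul_tmul, w.x_mul_H, w.h_mul_H, add_mul, mul_add,
      TensorProduct.smul_tmul']
  h_mul_X := by
    simp [Algebra.TensorProduct.tmul_mul_tmul, w.h_mul_X, w.h_mul_H, add_mul, mul_add,
      TensorProduct.smul_tmul']
  x_mul_X := by
    have e : x * X = σ • (X * x) + α • (1 - H * h) := by rw [← w.x_mul_X]; abel
    simp only [Algebra.TensorProduct.tmul_mul_tmul, add_mul, mul_add, one_mul, mul_one, e,
      w.h_mul_H, w.h_mul_X, w.x_mul_H, Algebra.TensorProduct.one_def, TensorProduct.add_tmul,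
      TensorProduct.tmul_add, TensorProduct.tmul_smul, TensorProduct.sub_tmul,
      TensorProduct.tmul_sub, ← TensorProduct.smul_tmul', smul_sub, smul_add]
    abel
  h_mul_H := by simp [Algebra.TensorProduct.tmul_mul_tmul, w.h_mul_H]

/-- The comultiplication: `Δ h = h ⊗ h`, `Δ x = x ⊗ h + 1 ⊗ x`, `Δ H = H ⊗ H`,
`Δ X = X ⊗ H + 1 ⊗ X`. -/
def comulHom : TwoTaft hq' hq σ α →ₐ[k] TwoTaft hq' hq σ α ⊗[k] TwoTaft hq' hq σ α :=
  lift hq' hq σ α ((relations hq' hq σ α).comul hq' hq)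

variable [NeZero m] [NeZero n]

theorem relations_counit : TwoTaftRelations m n q q' σ α (1 : k) 0 1 0 where
  h_pow := one_pow m
  H_pow := one_pow n
  x_pow := zero_pow (NeZero.ne m)
  X_pow := zero_pow (NeZero.ne n)
  x_mul_h := by simp
  X_mul_H := by simp
  x_mul_H := by simp
  h_mul_X := by simp
  x_mul_X := by simp
  h_mul_H := by simp

/-- The counit: `ε h = ε H = 1` and `ε x = ε X = 0`. -/
def counitHom : TwoTaft hq' hq σ α →ₐ[k] k :=
  lift hq' hq σ α (relations_counit σ α)

instance : Bialgebra k (TwoTaft hq' hq σ α) :=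
  Bialgebra.ofAlgHom (comulHom hq' hq σ α) (counitHom hq' hq σ α)
    (by apply algHom_ext <;>
      simp [comulHom, TensorProduct.add_tmul, TensorProduct.tmul_add,
        Algebra.TensorProduct.one_def, add_assoc])
    (by apply algHom_ext <;> simp [comulHom, counitHom])
    (by apply algHom_ext <;> simp [comulHom, counitHom])

theorem comul_h : Coalgebra.comul (R := k) (h hq' hq σ α) = h hq' hq σ α ⊗ₜ h hq' hq σ α :=
  lift_h hq' hq σ α _

theorem comul_x : Coalgebra.comul (R := k) (x hq' hq σ α) =
    x hq' hq σ α ⊗ₜ h hq' hq σ α + 1 ⊗ₜ x hq' hq σ α :=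
  lift_x hq' hq σ α _

theorem comul_H : Coalgebra.comul (R := k) (H hq' hq σ α) = H hq' hq σ α ⊗ₜ H hq' hq σ α :=
  lift_H hq' hq σ α _

theorem comul_X : Coalgebra.comul (R := k) (X hq' hq σ α) =
    X hq' hq σ α ⊗ₜ H hq' hq σ α + 1 ⊗ₜ X hq' hq σ α :=
  lift_X hq' hq σ α _

theorem counit_h : Coalgebra.counit (R := k) (h hq' hq σ α) = 1 := lift_h hq' hq σ α _

theorem counit_x : Coalgebra.counit (R := k) (x hq' hq σ α) = 0 := lift_x hq' hq σ α _

theorem counit_H : Coalgebra.counit (R := k) (H hq' hq σ α) = 1 := lift_H hq' hq σ α _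

theorem counit_X : Coalgebra.counit (R := k) (X hq' hq σ α) = 0 := lift_X hq' hq σ α _

/-- If `g ^ m = 1` then `g * g ^ (m - 1) = 1`. -/
theorem mul_pow_pred {B : Type*} [Ring B] {m : ℕ} [NeZero m] {g : B} (hg : g ^ m = 1) :
    g * g ^ (m - 1) = 1 := by
  rw [← pow_succ', Nat.sub_add_cancel (NeZero.one_le), hg]

/-- If `g ^ m = 1` then `g ^ (m - 1) * g = 1`. -/
theorem pow_pred_mul {B : Type*} [Ring B] {m : ℕ} [NeZero m] {g : B} (hg : g ^ m = 1) :
    g ^ (m - 1) * g = 1 := by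
  rw [← pow_succ, Nat.sub_add_cancel (NeZero.one_le), hg]

/-- If `y g = c g y` and `g ^ m = 1` then `g⁻¹ y = c y g⁻¹`. -/
theorem inv_mul_of_qcomm {k B : Type*} [Field k] [Ring B] [Algebra k B] {m : ℕ} [NeZero m]
    {c : k} {g y : B} (hg : g ^ m = 1) (hy : y * g = c • (g * y)) :
    g ^ (m - 1) * y = c • (y * g ^ (m - 1)) := by
  calc g ^ (m - 1) * y = g ^ (m - 1) * (y * g) * g ^ (m - 1) := by
        rw [mul_assoc, mul_assoc, mul_pow_pred hg, mul_one]
    _ = c • (y * g ^ (m - 1)) := by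
        rw [hy, mul_smul_comm, ← mul_assoc, pow_pred_mul hg, one_mul, smul_mul_assoc]

/-- If `g y = c y g` and `g ^ m = 1` then `y g⁻¹ = c g⁻¹ y`. -/
theorem mul_inv_of_qcomm {k B : Type*} [Field k] [Ring B] [Algebra k B] {m : ℕ} [NeZero m]
    {c : k} {g y : B} (hg : g ^ m = 1) (hy : g * y = c • (y * g)) :
    y * g ^ (m - 1) = c • (g ^ (m - 1) * y) := by
  calc y * g ^ (m - 1) = g ^ (m - 1) * (g * y) * g ^ (m - 1) := by
        rw [← mul_assoc, pow_pred_mul hg, one_mul]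
    _ = c • (g ^ (m - 1) * y) := by
        rw [hy, mul_smul_comm, smul_mul_assoc, mul_assoc, mul_assoc, mul_pow_pred hg, mul_one]

open MulOpposite in
/-- The relations are compatible with the antipode. -/
theorem _root_.TaftBicrossed.TwoTaftRelations.antipode {k B : Type*} [Field k] [Ring B]
    [Algebra k B] {m n : ℕ} [NeZero m] [NeZero n] {q q' σ α : k}
    {h x H X : B} (w : TwoTaftRelations m n q q' σ α h x H X) :
    TwoTaftRelations m n q q' σ α (op (h ^ (m - 1))) (op (-(x * h ^ (m - 1))))
      (op (H ^ (n - 1))) (op (-(X * H ^ (n - 1)))) where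
  h_pow := by rw [← op_pow, ← pow_mul, mul_comm, pow_mul, w.h_pow, one_pow, op_one]
  H_pow := by rw [← op_pow, ← pow_mul, mul_comm, pow_mul, w.H_pow, one_pow, op_one]
  x_pow := by
    rw [← op_pow, neg_pow, mul_pow_eq_zero_of_qcomm (inv_mul_of_qcomm w.h_pow w.x_mul_h) w.x_pow,
      mul_zero, op_zero]
  X_pow := by
    rw [← op_pow, neg_pow, mul_pow_eq_zero_of_qcomm (inv_mul_of_qcomm w.H_pow w.X_mul_H) w.X_pow,
      mul_zero, op_zero]
  x_mul_h := by
    rw [← op_mul, ← op_mul, ← op_smul, mul_neg, neg_mul, ← mul_assoc,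
      inv_mul_of_qcomm w.h_pow w.x_mul_h, smul_neg, smul_mul_assoc]
  X_mul_H := by
    rw [← op_mul, ← op_mul, ← op_smul, mul_neg, neg_mul, ← mul_assoc,
      inv_mul_of_qcomm w.H_pow w.X_mul_H, smul_neg, smul_mul_assoc]
  x_mul_H := by
    have hc : H ^ (n - 1) * h ^ (m - 1) = h ^ (m - 1) * H ^ (n - 1) :=
      ((show Commute h H from w.h_mul_H).symm.pow_pow _ _)
    rw [← op_mul, ← op_mul, ← op_smul, mul_neg, neg_mul, ← mul_assoc,
      inv_mul_of_qcomm w.H_pow w.x_mul_H, smul_neg, smul_mul_assoc, mul_assoc, mul_assoc, hc]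
  h_mul_X := by
    have hc : H ^ (n - 1) * h ^ (m - 1) = h ^ (m - 1) * H ^ (n - 1) :=
      ((show Commute h H from w.h_mul_H).symm.pow_pow _ _)
    rw [← op_mul, ← op_mul, ← op_smul, mul_neg, neg_mul, mul_assoc, hc, ← mul_assoc, ← mul_assoc,
      mul_inv_of_qcomm w.h_pow w.h_mul_X, smul_neg, smul_mul_assoc]
  x_mul_X := by
    have hc : H ^ (n - 1) * h ^ (m - 1) = h ^ (m - 1) * H ^ (n - 1) :=
      ((show Commute h H from w.h_mul_H).symm.pow_pow _ _)
    have e1 : X * H ^ (n - 1) * (x * h ^ (m - 1)) =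
        σ • (X * x) * (h ^ (m - 1) * H ^ (n - 1)) := by
      rw [mul_assoc, ← mul_assoc (H ^ (n - 1)), inv_mul_of_qcomm w.H_pow w.x_mul_H,
        smul_mul_assoc, mul_smul_comm, mul_assoc x, hc, smul_mul_assoc, mul_assoc]
    have e2 : σ • (x * h ^ (m - 1) * (X * H ^ (n - 1))) =
        x * X * (h ^ (m - 1) * H ^ (n - 1)) := by
      rw [mul_assoc, ← mul_assoc (h ^ (m - 1)), ← mul_smul_comm, ← smul_mul_assoc,
        ← mul_inv_of_qcomm w.h_pow w.h_mul_X]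
      simp only [mul_assoc]
    have e3 : H * h * (h ^ (m - 1) * H ^ (n - 1)) = 1 := by
      rw [mul_assoc, ← mul_assoc h, mul_pow_pred w.h_pow, one_mul, mul_pow_pred w.H_pow]
    rw [← op_mul, ← op_mul, ← op_mul, ← op_smul, ← op_sub, ← op_one, ← op_sub, ← op_smul,
      neg_mul_neg, neg_mul_neg, e1, e2, ← sub_mul, ← neg_sub, w.x_mul_X, ← smul_neg, neg_sub,
      smul_mul_assoc, sub_mul, e3, one_mul]
  h_mul_H := by
    have hc : H ^ (n - 1) * h ^ (m - 1) = h ^ (m - 1) * H ^ (n - 1) :=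
      ((show Commute h H from w.h_mul_H).symm.pow_pow _ _)
    rw [← op_mul, ← op_mul, hc]

/-- The antipode as a homomorphism to the opposite algebra: `S h = h⁻¹`, `S x = - x h⁻¹`,
`S H = H⁻¹`, `S X = - X H⁻¹`. -/
def antipodeHom : TwoTaft hq' hq σ α →ₐ[k] (TwoTaft hq' hq σ α)ᵐᵒᵖ :=
  lift hq' hq σ α (relations hq' hq σ α).antipode

theorem antipode_left_gen (g : TwoTaftGen) :
    LinearMap.mul' k _ (LinearMap.rTensor _
      ((MulOpposite.opLinearEquiv k).symm.toLinearMap ∘ₗ (antipodeHom hq' hq σ α).toLinearMap)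
      (Coalgebra.comul (gen hq' hq σ α g))) =
      algebraMap k _ (Coalgebra.counit (gen hq' hq σ α g)) := by
  have w := relations hq' hq σ α
  cases g
  · refine (congrArg _ (congrArg _ (comul_h hq' hq σ α))).trans
      (Eq.trans ?_ (congrArg _ (counit_h hq' hq σ α)).symm)
    simp [antipodeHom, pow_pred_mul w.h_pow]
  · refine (congrArg _ (congrArg _ (comul_x hq' hq σ α))).trans
      (Eq.trans ?_ (congrArg _ (counit_x hq' hq σ α)).symm)
    simp [antipodeHom, pow_pred_mul w.h_pow, mul_assoc]
  · refine (congrArg _ (congrArg _ (comul_H hq' hq σ α))).trans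
      (Eq.trans ?_ (congrArg _ (counit_H hq' hq σ α)).symm)
    simp [antipodeHom, pow_pred_mul w.H_pow]
  · refine (congrArg _ (congrArg _ (comul_X hq' hq σ α))).trans
      (Eq.trans ?_ (congrArg _ (counit_X hq' hq σ α)).symm)
    simp [antipodeHom, pow_pred_mul w.H_pow, mul_assoc]

theorem antipode_right_gen (g : TwoTaftGen) :
    LinearMap.mul' k _ (LinearMap.lTensor _
      ((MulOpposite.opLinearEquiv k).symm.toLinearMap ∘ₗ (antipodeHom hq' hq σ α).toLinearMap)
      (Coalgebra.comul (gen hq' hq σ α g))) =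
      algebraMap k _ (Coalgebra.counit (gen hq' hq σ α g)) := by
  have w := relations hq' hq σ α
  cases g
  · refine (congrArg _ (congrArg _ (comul_h hq' hq σ α))).trans
      (Eq.trans ?_ (congrArg _ (counit_h hq' hq σ α)).symm)
    simp [antipodeHom, mul_pow_pred w.h_pow]
  · refine (congrArg _ (congrArg _ (comul_x hq' hq σ α))).trans
      (Eq.trans ?_ (congrArg _ (counit_x hq' hq σ α)).symm)
    simp [antipodeHom]
  · refine (congrArg _ (congrArg _ (comul_H hq' hq σ α))).trans
      (Eq.trans ?_ (congrArg _ (counit_H hq' hq σ α)).symm)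
    simp [antipodeHom, mul_pow_pred w.H_pow]
  · refine (congrArg _ (congrArg _ (comul_X hq' hq σ α))).trans
      (Eq.trans ?_ (congrArg _ (counit_X hq' hq σ α)).symm)
    simp [antipodeHom]

instance : HopfAlgebra k (TwoTaft hq' hq σ α) where
  antipode := (MulOpposite.opLinearEquiv k).symm.toLinearMap ∘ₗ
    (antipodeHom hq' hq σ α).toLinearMap
  mul_antipode_rTensor_comul := by
    refine antipode_left_of_adjoin _ (by simp) (by simp) (adjoin_gen hq' hq σ α) ?_
    rintro _ ⟨g, rfl⟩
    exact antipode_left_gen hq' hq σ α g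
  mul_antipode_lTensor_comul := by
    refine antipode_right_of_adjoin _ (by simp) (by simp) (adjoin_gen hq' hq σ α) ?_
    rintro _ ⟨g, rfl⟩
    exact antipode_right_gen hq' hq σ α g

/-- If `y g = c g y`, `g ^ m = 1` and `c ^ m = 1` then `y g⁻¹ = c⁻¹ g⁻¹ y`. -/
theorem mul_inv_eq_smul {k B : Type*} [Field k] [Ring B] [Algebra k B] {m : ℕ} [NeZero m]
    {c : k} {g y : B} (hc : c ^ m = 1) (hg : g ^ m = 1) (hy : y * g = c • (g * y)) :
    y * g ^ (m - 1) = c ^ (m - 1) • (g ^ (m - 1) * y) := by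
  rw [inv_mul_of_qcomm hg hy, smul_smul, ← pow_succ, Nat.sub_add_cancel (NeZero.one_le), hc,
    one_smul]

theorem antipode_h : HopfAlgebra.antipode k (h hq' hq σ α) = h hq' hq σ α ^ (m - 1) := by
  change MulOpposite.unop (antipodeHom hq' hq σ α (h hq' hq σ α)) = _
  simp [antipodeHom]

theorem antipode_H : HopfAlgebra.antipode k (H hq' hq σ α) = H hq' hq σ α ^ (n - 1) := by
  change MulOpposite.unop (antipodeHom hq' hq σ α (H hq' hq σ α)) = _
  simp [antipodeHom]

theorem antipode_x : HopfAlgebra.antipode k (x hq' hq σ α) =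
    -(q ^ (m - 1) • (h hq' hq σ α ^ (m - 1) * x hq' hq σ α)) := by
  have w := relations hq' hq σ α
  rw [← mul_inv_eq_smul hq.pow_eq_one w.h_pow w.x_mul_h]
  change MulOpposite.unop (antipodeHom hq' hq σ α (x hq' hq σ α)) = _
  simp [antipodeHom]

theorem antipode_X : HopfAlgebra.antipode k (X hq' hq σ α) =
    -(q' ^ (n - 1) • (H hq' hq σ α ^ (n - 1) * X hq' hq σ α)) := by
  have w := relations hq' hq σ α
  rw [← mul_inv_eq_smul hq'.pow_eq_one w.H_pow w.X_mul_H]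
  change MulOpposite.unop (antipodeHom hq' hq σ α (X hq' hq σ α)) = _
  simp [antipodeHom]

end TwoTaft

/-- The Hopf algebra `T^σ_{n,m}(q', q)`: the case `α = 0`, with relations
`h ^ m = H ^ n = 1`, `x ^ m = X ^ n = 0`, `x h = q h x`, `X H = q' H X`,
`x H = σ H x`, `h X = σ X h`, `x X = σ X x`, `h H = H h`. -/
abbrev TaftSigma {k : Type*} [Field k] {m n : ℕ} {q q' : k} (hq' : IsPrimitiveRoot q' n)
    (hq : IsPrimitiveRoot q m) (σ : k) : Type _ :=
  TwoTaft hq' hq σ 0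

theorem isPrimitiveRoot_pow_pred {k : Type*} [Field k] {n : ℕ} [NeZero n] {q : k}
    (hq : IsPrimitiveRoot q n) : IsPrimitiveRoot (q ^ (n - 1)) n :=
  hq.pow_of_coprime _ ((Nat.coprime_self_sub_left NeZero.one_le).2 (Nat.coprime_one_left n))

/-- The Hopf algebra `Q^α_n(q)`: the case `m = n`, `q' = q ^ (n - 1)`, `σ = q`, with relations
`h ^ n = H ^ n = 1`, `x ^ n = X ^ n = 0`, `x h = q h x`, `X H = q ^ (n - 1) H X`,
`x H = q H x`, `h X = q X h`, `x X - q X x = α (1 - H h)`, `h H = H h`. -/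
abbrev TaftQ {k : Type*} [Field k] {n : ℕ} [NeZero n] {q : k} (hq : IsPrimitiveRoot q n)
    (α : k) : Type _ :=
  TwoTaft (isPrimitiveRoot_pow_pred hq) hq q α

end TwoTaft

/-- A Hopf algebra `E` factors through the Hopf algebras `A` and `L` if there are injective Hopf
algebra maps `i : A → E` and `j : L → E` such that `A ⊗ L → E`, `a ⊗ l ↦ i a * j l`, is bijective.
(A bialgebra map between Hopf algebras automatically commutes with the antipodes.) -/
def FactorsThrough (k A L E : Type*) [Field k] [Ring A] [HopfAlgebra k A] [Ring L]
    [HopfAlgebra k L] [Ring E] [HopfAlgebra k E] : Prop :=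
  ∃ (i : A →ₐc[k] E) (j : L →ₐc[k] E), Function.Injective i ∧ Function.Injective j ∧
    Function.Bijective (LinearMap.mul' k E ∘ₗ
      TensorProduct.map (i : A →ₗ[k] E) (j : L →ₗ[k] E))

end TaftBicrossed

end

namespace TaftBicrossed

/-! Both families are instances of one presentation `TwoTaft` with parameters σ and α. It suffices
to show that the Hopf algebras with a factorization are exactly those `TwoTaft` with σ^m = σ^n = 1
and either α = 0, or m = n, σ = q and q'q = 1.

Forward direction. Multiplication identifies E, as a coalgebra only, with the tensor product of the
two Taft algebras. There the skew primitive elements are known (`skew_primitive`): for a group-like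
g ≠ 1 they are combinations of X (only if g = H), x (only if g = h) and g - 1. The elements hXh⁻¹,
H⁻¹xH and xX - σXx are skew primitive, the last one after a comparison of coproducts
(`skew_cross_term_eq_zero`), so each is determined up to scalars. This yields all the mixed
relations; the constraints on σ and α come from h^m = H^n = 1 and from commuting xX - σXx past h and
H (`exists_relations_of_coalgEquiv`). The resulting map from `TwoTaft` to E is bijective because
products of the two Taft subalgebras already span `TwoTaft` (`mul_map_surjective`).

The skew primitives are found by means of the operator `hit f`, a ↦ ∑ a₁ f(a₂), where f is the
functional dual to x. It acts as a q-derivative in x, hence is nilpotent, and in characteristic zero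
its kernel is the group algebra. On a tensor product the two such operators commute; group-likes are
eigenvectors, so they are annihilated by the functionals; and an element killed by both operators is
cocommutative.

Converse. Collapse of the presentation has to be excluded. `exists_action` lets `TwoTaft` act on the
tensor product of the two Taft algebras as it would act on itself by left multiplication, and
evaluation at 1 ⊗ 1 inverts the multiplication map. -/

theorem left_ideal_induction {k A : Type*} [Field k] [Ring A] [Algebra k A] {s : Set A}
    (hs : Algebra.adjoin k s = ⊤) (p : Submodule k A) (h1 : 1 ∈ p)
    (hp : ∀ a ∈ s, ∀ b ∈ p, a * b ∈ p) (a : A) : a ∈ p := by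
  -- Stability of p under left multiplication by a, unlike membership of a, passes to products.
  have key : ∀ b ∈ p, a * b ∈ p := by
    have ha : a ∈ Algebra.adjoin k s := hs ▸ Algebra.mem_top
    induction ha using Algebra.adjoin_induction with
    | mem x hx => exact hp x hx
    | algebraMap r =>
      intro b hb
      rw [← Algebra.smul_def]
      exact p.smul_mem r hb
    | add x y _ _ hx hy =>
      intro b hb
      rw [add_mul]
      exact p.add_mem (hx b hb) (hy b hb)
    | mul x y _ _ hx hy =>
      intro b hb
      rw [mul_assoc]
      exact hx _ (hy b hb)
  simpa using key 1 h1

/-! ### The Taft algebra: monomials, the functional dual to x, and its q-derivative. -/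

namespace Taft

variable {k : Type*} [Field k] {m : ℕ} {q : k} (hq : IsPrimitiveRoot q m)

theorem left_induction (p : Submodule k (Taft hq)) (h1 : 1 ∈ p)
    (hh : ∀ a ∈ p, h hq * a ∈ p) (hx : ∀ a ∈ p, x hq * a ∈ p) (a : Taft hq) : a ∈ p := by
  refine left_ideal_induction (adjoin_gen hq) p h1 ?_ a
  rintro _ ⟨_ | _, rfl⟩
  exacts [hh, hx]

theorem linearMap_ext_of_mul {V : Type*} [AddCommGroup V] [Module k V] {f g : Taft hq →ₗ[k] V}
    (h1 : f 1 = g 1) (hh : ∀ a, f a = g a → f (h hq * a) = g (h hq * a))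
    (hx : ∀ a, f a = g a → f (x hq * a) = g (x hq * a)) : f = g :=
  LinearMap.ext fun a => left_induction hq (LinearMap.eqLocus f g) h1 hh hx a

/-- The algebra endomorphism `h ↦ h`, `x ↦ c x`. -/
noncomputable def scale (c : k) : Taft hq →ₐ[k] Taft hq :=
  lift hq (h hq) (c • x hq) (h_pow hq) (by rw [smul_pow, x_pow, smul_zero])
    (by rw [smul_mul_assoc, x_mul_h, mul_smul_comm, smul_comm])

@[simp] theorem scale_h (c : k) : scale hq c (h hq) = h hq := lift_h hq _ _ _ _ _

@[simp] theorem scale_x (c : k) : scale hq c (x hq) = c • x hq := lift_x hq _ _ _ _ _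

theorem scale_pow_monomial (c : k) (l i j : ℕ) :
    ((scale hq c).toLinearMap ^ l) (h hq ^ i * x hq ^ j) =
      (c ^ j) ^ l • (h hq ^ i * x hq ^ j) := by
  induction l with
  | zero => simp
  | succ l ih =>
    rw [pow_succ', Module.End.mul_apply, ih]
    simp [smul_pow, smul_smul, pow_succ]

/-- Monomials `h ^ i * x ^ j` span the Taft algebra. -/
theorem monomial_induction (p : Submodule k (Taft hq))
    (hp : ∀ i j, h hq ^ i * x hq ^ j ∈ p) (a : Taft hq) : a ∈ p := by
  have key : a ∈ Submodule.span k (Set.range fun t : ℕ × ℕ => h hq ^ t.1 * x hq ^ t.2) := by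
    refine left_induction hq _ (Submodule.subset_span (Set.mem_range.2 ⟨(0, 0), by simp⟩)) ?_ ?_ a
    · intro a ha
      induction ha using Submodule.span_induction with
      | mem a ha =>
        obtain ⟨⟨i, j⟩, rfl⟩ := ha
        exact Submodule.subset_span ⟨(i + 1, j), by simp [pow_succ', mul_assoc]⟩
      | zero => simp
      | add a b _ _ ha hb => rw [mul_add]; exact add_mem ha hb
      | smul c a _ ha => rw [mul_smul_comm]; exact Submodule.smul_mem _ _ ha
    · intro a ha
      induction ha using Submodule.span_induction with
      | mem a ha =>
        obtain ⟨⟨i, j⟩, rfl⟩ := ha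
        simp only
        rw [← mul_assoc, mul_pow_of_qcomm (x_mul_h hq), smul_mul_assoc, mul_assoc, ← pow_succ']
        exact Submodule.smul_mem _ _ (Submodule.subset_span ⟨(i, j + 1), rfl⟩)
      | zero => simp
      | add a b _ _ ha hb => rw [mul_add]; exact add_mem ha hb
      | smul c a _ ha => rw [mul_smul_comm]; exact Submodule.smul_mem _ _ ha
  refine (Submodule.span_le.2 ?_) key
  rintro _ ⟨⟨i, j⟩, rfl⟩
  exact hp i j

theorem linearMap_ext_monomial {V : Type*} [AddCommGroup V] [Module k V] {f g : Taft hq →ₗ[k] V}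
    (hfg : ∀ i j, f (h hq ^ i * x hq ^ j) = g (h hq ^ i * x hq ^ j)) : f = g :=
  LinearMap.ext fun a => monomial_induction hq (LinearMap.eqLocus f g) hfg a

variable [NeZero m]

/-- The character with `h ↦ q` and `x ↦ 0`. -/
noncomputable def character : Taft hq →ₐ[k] k :=
  lift hq q 0 hq.pow_eq_one (zero_pow (NeZero.ne m)) (by simp)

@[simp] theorem character_h : character hq (h hq) = q := lift_h hq _ _ _ _ _

@[simp] theorem character_x : character hq (x hq) = 0 := lift_x hq _ _ _ _ _

/-- The projection onto the group algebra: `h ↦ h` and `x ↦ 0`. -/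
noncomputable def proj : Taft hq →ₐ[k] Taft hq :=
  lift hq (h hq) 0 (h_pow hq) (zero_pow (NeZero.ne m)) (by simp)

@[simp] theorem proj_h : proj hq (h hq) = h hq := lift_h hq _ _ _ _ _

@[simp] theorem proj_x : proj hq (x hq) = 0 := lift_x hq _ _ _ _ _

/-- The representation `h ↦ diag(1, q)`, `x ↦ E₁₂`. -/
noncomputable def rep (hm : m ≠ 1) : Taft hq →ₐ[k] Matrix (Fin 2) (Fin 2) k :=
  lift hq (Matrix.diagonal ![1, q]) !![0, 1; 0, 0]
    (by
      rw [Matrix.diagonal_pow, ← Matrix.diagonal_one]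
      congr 1
      ext i
      fin_cases i <;> simp [hq.pow_eq_one])
    (by
      have h0 := NeZero.ne m
      obtain ⟨l, rfl⟩ : ∃ l, m = l + 2 := ⟨m - 2, by omega⟩
      have h2 : (!![0, 1; 0, 0] : Matrix (Fin 2) (Fin 2) k) ^ 2 = 0 := by
        ext i j; fin_cases i <;> fin_cases j <;> simp [pow_two]
      rw [pow_add, h2, mul_zero])
    (by ext i j; fin_cases i <;> fin_cases j <;> simp [Matrix.mul_apply, Fin.sum_univ_two])

/-- The functional dual to `x`: the skew derivation with `h ↦ 0`, `x ↦ 1`. -/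
noncomputable def dualX (hm : m ≠ 1) : Taft hq →ₗ[k] k :=
  Matrix.entryLinearMap k k 0 1 ∘ₗ (rep hq hm).toLinearMap

variable (hm : m ≠ 1)

theorem rep_zero_zero (a : Taft hq) : rep hq hm a 0 0 = Coalgebra.counit a := by
  -- Vanishing of the (1,0) entry has to be carried along: the (0,0) entry of x·a is the (1,0) entry
  -- of a.
  refine (left_induction hq
    (LinearMap.eqLocus (Matrix.entryLinearMap k k 0 0 ∘ₗ (rep hq hm).toLinearMap)
        (Coalgebra.counit (R := k) (A := Taft hq)) ⊓
      LinearMap.ker (Matrix.entryLinearMap k k 1 0 ∘ₗ (rep hq hm).toLinearMap))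
    ?_ ?_ ?_ a).1
  · simp
  · rintro a ⟨ha, ha'⟩
    simp only [SetLike.mem_coe, LinearMap.mem_eqLocus, LinearMap.mem_ker, LinearMap.comp_apply,
      AlgHom.toLinearMap_apply, Matrix.entryLinearMap_apply, Submodule.mem_inf] at ha ha' ⊢
    simp [rep, Matrix.mul_apply, Fin.sum_univ_two, counit_h] at ha ha' ⊢
    exact ⟨ha, Or.inr ha'⟩
  · rintro a ⟨ha, ha'⟩
    simp only [SetLike.mem_coe, LinearMap.mem_eqLocus, LinearMap.mem_ker, LinearMap.comp_apply,
      AlgHom.toLinearMap_apply, Matrix.entryLinearMap_apply, Submodule.mem_inf] at ha ha' ⊢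
    simp [rep, Matrix.mul_apply, Fin.sum_univ_two, counit_x] at ha ha' ⊢
    exact ha'

theorem dualX_one : dualX hq hm 1 = 0 := by simp [dualX]

theorem dualX_h : dualX hq hm (h hq) = 0 := by simp [dualX, rep]

theorem dualX_x : dualX hq hm (x hq) = 1 := by simp [dualX, rep]

theorem dualX_h_mul (a : Taft hq) : dualX hq hm (h hq * a) = dualX hq hm a := by
  simp [dualX, rep, Matrix.mul_apply, Fin.sum_univ_two]

theorem dualX_mul_h (a : Taft hq) : dualX hq hm (a * h hq) = q * dualX hq hm a := by
  simp [dualX, rep, Matrix.mul_apply, Fin.sum_univ_two, mul_comm]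

theorem dualX_mul_x (a : Taft hq) : dualX hq hm (a * x hq) = Coalgebra.counit (R := k) a := by
  rw [← rep_zero_zero hq hm]
  simp [dualX, rep, Matrix.mul_apply, Fin.sum_univ_two]

/-- The operator `a ↦ ∑ a₁ f (a₂)` for a functional `f` on a coalgebra. -/
noncomputable def _root_.TaftBicrossed.hit {k C : Type*} [Field k] [AddCommGroup C] [Module k C]
    [Coalgebra k C] (f : C →ₗ[k] k) : C →ₗ[k] C :=
  (TensorProduct.rid k C).toLinearMap ∘ₗ f.lTensor C ∘ₗ Coalgebra.comul

theorem _root_.TaftBicrossed.hit_apply {k C : Type*} [Field k] [AddCommGroup C] [Module k C]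
    [Coalgebra k C] (f : C →ₗ[k] k) (c : C) :
    hit f c = TensorProduct.rid k C (f.lTensor C (Coalgebra.comul c)) := rfl

theorem hit_dualX_one : hit (dualX hq hm) 1 = 0 := by
  simp [hit_apply, Algebra.TensorProduct.one_def, dualX_one]

theorem hit_dualX_h_mul (a : Taft hq) :
    hit (dualX hq hm) (h hq * a) = h hq * hit (dualX hq hm) a := by
  rw [hit_apply, hit_apply, Bialgebra.comul_mul, comul_h]
  induction Coalgebra.comul (R := k) a using TensorProduct.induction_on with
  | zero => simp
  | add s t hs ht => simp only [mul_add, map_add, hs, ht]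
  | tmul b c => simp [dualX_h_mul]

theorem hit_dualX_mul_x (a : Taft hq) :
    hit (dualX hq hm) (a * x hq) = q • (hit (dualX hq hm) a * x hq) + a := by
  have ha : TensorProduct.rid k _ ((Coalgebra.counit (R := k)).lTensor (Taft hq)
      (Coalgebra.comul (R := k) a)) = a := by simp
  -- The bare summand a becomes (id ⊗ ε)Δ(a), so that both sides are linear in Δ(a) and can be
  -- compared on pure tensors.
  nth_rewrite 3 [← ha]
  rw [hit_apply, hit_apply, Bialgebra.comul_mul, comul_x]
  clear ha
  induction Coalgebra.comul (R := k) a using TensorProduct.induction_on with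
  | zero => simp
  | add s t hs ht => simp only [add_mul, map_add, smul_add, hs, ht]; abel
  | tmul b c => simp [mul_add, dualX_mul_h, dualX_mul_x, mul_smul]

theorem hit_dualX_h_pow_mul (i : ℕ) (a : Taft hq) :
    hit (dualX hq hm) (h hq ^ i * a) = h hq ^ i * hit (dualX hq hm) a := by
  induction i with
  | zero => simp
  | succ i ih => rw [pow_succ', mul_assoc, hit_dualX_h_mul, ih, mul_assoc]

theorem hit_dualX_h_pow (i : ℕ) : hit (dualX hq hm) (h hq ^ i) = 0 := by
  have := hit_dualX_h_pow_mul hq hm i 1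
  rwa [mul_one, hit_dualX_one, mul_zero] at this

/-- The scalar is the q-integer 1 + q + ... + q^j; only the drop of the x-degree by one matters for
nilpotency. -/
theorem exists_hit_dualX_monomial (i j : ℕ) :
    ∃ c : k, hit (dualX hq hm) (h hq ^ i * x hq ^ (j + 1)) = c • (h hq ^ i * x hq ^ j) := by
  induction j with
  | zero => exact ⟨1, by simp [hit_dualX_mul_x, hit_dualX_h_pow]⟩
  | succ j ih =>
    obtain ⟨c, hc⟩ := ih
    refine ⟨q * c + 1, ?_⟩
    rw [pow_succ, ← mul_assoc, hit_dualX_mul_x, hc, smul_mul_assoc, mul_assoc, ← pow_succ,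
      smul_smul, add_smul, one_smul]

theorem hit_dualX_pow_monomial (i j : ℕ) :
    (hit (dualX hq hm) ^ (j + 1)) (h hq ^ i * x hq ^ j) = 0 := by
  induction j with
  | zero => simp [hit_dualX_h_pow]
  | succ j ih =>
    obtain ⟨c, hc⟩ := exists_hit_dualX_monomial hq hm i j
    rw [pow_succ, Module.End.mul_apply, hc, map_smul, ih, smul_zero]

theorem hit_dualX_pow : hit (dualX hq hm) ^ m = 0 := by
  refine linearMap_ext_monomial hq fun i j => ?_
  rcases lt_or_ge j m with hj | hj
  · have hm' : m = m - (j + 1) + (j + 1) := by omega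
    rw [congrArg (hit (dualX hq hm) ^ ·) hm', pow_add, Module.End.mul_apply,
      hit_dualX_pow_monomial, map_zero, LinearMap.zero_apply]
  · rw [← Nat.add_sub_cancel' hj, pow_add (x hq), x_pow, zero_mul, mul_zero, map_zero, map_zero]

/-- This is the q-difference quotient: on a monomial of x-degree j, `hit` multiplies by the
q-integer [j] and lowers the degree, and (q - 1)[j] = q^j - 1. -/
theorem smul_hit_dualX_mul_x (a : Taft hq) :
    (q - 1) • (hit (dualX hq hm) a * x hq) = scale hq q a - a := by
  have key : (q - 1) • (LinearMap.mulRight k (x hq) ∘ₗ hit (dualX hq hm)) =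
      (scale hq q).toLinearMap - LinearMap.id := by
    refine linearMap_ext_monomial hq fun i j => ?_
    induction j with
    | zero => simp [hit_dualX_h_pow]
    | succ j ih =>
      simp only [LinearMap.smul_apply, LinearMap.comp_apply, LinearMap.mulRight_apply,
        LinearMap.sub_apply, AlgHom.toLinearMap_apply, LinearMap.id_apply] at ih ⊢
      rw [pow_succ, ← mul_assoc, hit_dualX_mul_x, add_mul, smul_add, smul_mul_assoc, smul_comm,
        ← smul_mul_assoc, ih, map_mul _ _ (x hq), scale_x, sub_mul, smul_sub, mul_smul_comm, sub_smul,
        one_smul]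
      abel
  exact LinearMap.congr_fun key a

/-- Averaging over the grading automorphism projects to x-degree 0, since ∑ q^(jl) over l < m
vanishes for 0 < j < m. -/
theorem sum_scale_pow [CharZero k] :
    ∑ l ∈ Finset.range m, (scale hq q).toLinearMap ^ l = (m : k) • (proj hq).toLinearMap := by
  refine linearMap_ext_monomial hq fun i j => ?_
  simp only [LinearMap.sum_apply, scale_pow_monomial, ← Finset.sum_smul, LinearMap.smul_apply,
    AlgHom.toLinearMap_apply, map_mul, map_pow, proj_h, proj_x]
  rcases Nat.eq_zero_or_pos j with rfl | hj
  · simp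
  rw [zero_pow hj.ne', mul_zero, smul_zero]
  rcases lt_or_ge j m with hjm | hjm
  · have h1 : q ^ j ≠ 1 := hq.pow_ne_one_of_pos_of_lt hj.ne' hjm
    rw [geom_sum_eq h1, ← pow_mul, mul_comm j, pow_mul, hq.pow_eq_one, one_pow, sub_self,
      zero_div, zero_smul]
  · rw [← Nat.add_sub_cancel' hjm, pow_add (x hq), x_pow, zero_mul, mul_zero, smul_zero]

/-- Up to elements of the group algebra, an element is determined by its image under
`hit (dualX hq hm)`. -/
theorem exists_proj_add_comp_hit_dualX [CharZero k] :
    ∃ Q : Taft hq →ₗ[k] Taft hq,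
      LinearMap.id = (proj hq).toLinearMap + Q ∘ₗ hit (dualX hq hm) := by
  have hm0 : (m : k) ≠ 0 := Nat.cast_ne_zero.2 (NeZero.ne m)
  set θ : Module.End k (Taft hq) := (scale hq q).toLinearMap with hθ
  set G : Module.End k (Taft hq) :=
    ∑ l ∈ Finset.range m, ∑ i ∈ Finset.range l, θ ^ i
  -- Each inner geometric sum telescopes to θ^l - 1. As θ - 1 factors through `hit`, division by m
  -- writes id - proj as a map composed with `hit`.
  have h1 : G * (θ - 1) = (m : k) • ((proj hq).toLinearMap - LinearMap.id) := by
    simp only [G]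
    rw [Finset.sum_mul, Finset.sum_congr rfl fun l _ => geom_sum_mul θ l, Finset.sum_sub_distrib, hθ, sum_scale_pow, smul_sub]
    simp only [Finset.sum_const, Finset.card_range, Nat.cast_smul_eq_nsmul]
    rfl
  refine ⟨-((m : k)⁻¹ • (q - 1) • (G ∘ₗ LinearMap.mulRight k (x hq))), LinearMap.ext fun a => ?_⟩
  have h2 := LinearMap.congr_fun h1 a
  simp only [Module.End.mul_apply, LinearMap.sub_apply, Module.End.one_apply, hθ,
    AlgHom.toLinearMap_apply, ← smul_hit_dualX_mul_x hq hm, LinearMap.smul_apply,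
    LinearMap.id_apply] at h2
  rw [map_smul] at h2
  change a = proj hq a + -((m : k)⁻¹ • (q - 1) • G (hit (dualX hq hm) a * x hq))
  rw [h2, smul_smul, inv_mul_cancel₀ hm0, one_smul]
  abel

end Taft


/-- The functional `c ⊗ d ↦ f c * g d`. -/
noncomputable def tensorFunctional {k C D : Type*} [Field k] [AddCommGroup C] [Module k C]
    [AddCommGroup D] [Module k D] (f : C →ₗ[k] k) (g : D →ₗ[k] k) : C ⊗[k] D →ₗ[k] k :=
  LinearMap.mul' k k ∘ₗ TensorProduct.map f g

@[simp] theorem tensorFunctional_tmul {k C D : Type*} [Field k] [AddCommGroup C] [Module k C]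
    [AddCommGroup D] [Module k D] (f : C →ₗ[k] k) (g : D →ₗ[k] k) (c : C) (d : D) :
    tensorFunctional f g (c ⊗ₜ d) = f c * g d := by simp [tensorFunctional]

/-! ### Hit operators on tensor products and on group-like elements. -/

section hit

variable {k C D : Type*} [Field k] [AddCommGroup C] [Module k C] [Coalgebra k C]
  [AddCommGroup D] [Module k D] [Coalgebra k D]

theorem hit_counit : hit (Coalgebra.counit (R := k) (A := C)) = LinearMap.id := by
  ext c
  simp [hit_apply]

theorem hit_tensorFunctional (f : C →ₗ[k] k) (g : D →ₗ[k] k) :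
    hit (tensorFunctional f g) = TensorProduct.map (hit f) (hit g) := by
  ext c d
  simp only [TensorProduct.AlgebraTensorModule.curry_apply, LinearMap.restrictScalars_self,
    TensorProduct.curry_apply, TensorProduct.map_tmul, hit_apply, TensorProduct.comul_tmul]
  induction Coalgebra.comul (R := k) c using TensorProduct.induction_on with
  | zero => simp
  | add s t hs ht => simp only [TensorProduct.add_tmul, map_add, hs, ht]
  | tmul c₁ c₂ =>
    induction Coalgebra.comul (R := k) d using TensorProduct.induction_on with
    | zero => simp
    | add s t hs ht => simp only [TensorProduct.tmul_add, map_add, hs, ht]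
    | tmul d₁ d₂ => simp [TensorProduct.smul_tmul', TensorProduct.tmul_smul, smul_smul, mul_comm]

/-- A group-like element is an eigenvector of `hit F`. -/
theorem hit_of_comul_eq_tmul (F : C →ₗ[k] k) {g : C} (hg : Coalgebra.comul (R := k) g = g ⊗ₜ g) :
    hit F g = F g • g := by
  simp [hit_apply, hg]

/-- F g is the eigenvalue of a nilpotent operator at the eigenvector g. -/
theorem apply_eq_zero_of_hit_nilpotent {F : C →ₗ[k] k} (hF : IsNilpotent (hit F)) {g : C}
    (hg0 : g ≠ 0) (hg : Coalgebra.comul (R := k) g = g ⊗ₜ g) : F g = 0 := by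
  obtain ⟨N, hN⟩ := hF
  have h : ∀ l : ℕ, (hit F ^ l) g = F g ^ l • g := by
    intro l
    induction l with
    | zero => simp
    | succ l ih =>
      rw [pow_succ', Module.End.mul_apply, ih, map_smul, hit_of_comul_eq_tmul F hg, smul_smul,
        pow_succ]
  have := h N
  rw [hN, LinearMap.zero_apply] at this
  exact eq_zero_of_pow_eq_zero ((smul_eq_zero.1 this.symm).resolve_right hg0)

end hit

/-- The projection lands in the algebra generated by the group-like h. Both sides are algebra maps
in a, so generators suffice. -/
theorem Taft.comm_comul_proj {k : Type*} [Field k] {m : ℕ} [NeZero m] {q : k}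
    (hq : IsPrimitiveRoot q m) (a : Taft hq) :
    TensorProduct.comm k _ _ (Coalgebra.comul (R := k) (proj hq a)) =
      Coalgebra.comul (R := k) (proj hq a) := by
  have : ((Algebra.TensorProduct.comm k (Taft hq) (Taft hq)).toAlgHom.comp
      (Bialgebra.comulAlgHom k (Taft hq))).comp (proj hq) =
      (Bialgebra.comulAlgHom k (Taft hq)).comp (proj hq) := by
    apply algHom_ext
    · simp [comul_h]
    · simp
  exact DFunLike.congr_fun this a

theorem comm_comul_tmul {k C D : Type*} [Field k] [AddCommGroup C] [Module k C] [Coalgebra k C]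
    [AddCommGroup D] [Module k D] [Coalgebra k D] {c : C} {d : D}
    (hc : TensorProduct.comm k _ _ (Coalgebra.comul (R := k) c) = Coalgebra.comul (R := k) c)
    (hd : TensorProduct.comm k _ _ (Coalgebra.comul (R := k) d) = Coalgebra.comul (R := k) d) :
    TensorProduct.comm k _ _ (Coalgebra.comul (R := k) (c ⊗ₜ[k] d)) =
      Coalgebra.comul (R := k) (c ⊗ₜ[k] d) := by
  rw [TensorProduct.comul_tmul]
  nth_rewrite 2 [← hc, ← hd]
  induction Coalgebra.comul (R := k) c using TensorProduct.induction_on with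
  | zero => simp
  | add s t hs ht => simp only [TensorProduct.add_tmul, map_add, hs, ht]
  | tmul c₁ c₂ =>
    induction Coalgebra.comul (R := k) d using TensorProduct.induction_on with
    | zero => simp
    | add s t hs ht => simp only [TensorProduct.tmul_add, map_add, hs, ht]
    | tmul d₁ d₂ => simp

/-! ### Skew primitive elements of the tensor product of two Taft algebras. -/

section SkewPrimitive

variable {k : Type*} [Field k] {m n : ℕ} [NeZero m] [NeZero n] {q q' : k}
  (hq : IsPrimitiveRoot q m) (hq' : IsPrimitiveRoot q' n) (hm : m ≠ 1) (hn : n ≠ 1)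

/-- The functional dual to `X ⊗ 1`. -/
noncomputable def dualLeft : Taft hq' ⊗[k] Taft hq →ₗ[k] k :=
  tensorFunctional (Taft.dualX hq' hn) Coalgebra.counit

/-- The functional dual to `1 ⊗ x`. -/
noncomputable def dualRight : Taft hq' ⊗[k] Taft hq →ₗ[k] k :=
  tensorFunctional Coalgebra.counit (Taft.dualX hq hm)

theorem hit_dualLeft : hit (dualLeft hq hq' hn) =
    TensorProduct.map (hit (Taft.dualX hq' hn)) LinearMap.id := by
  rw [dualLeft, hit_tensorFunctional, hit_counit]

theorem hit_dualRight : hit (dualRight hq hq' hm) =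
    TensorProduct.map LinearMap.id (hit (Taft.dualX hq hm)) := by
  rw [dualRight, hit_tensorFunctional, hit_counit]

theorem hit_dualLeft_hit_dualRight (b : Taft hq' ⊗[k] Taft hq) :
    hit (dualLeft hq hq' hn) (hit (dualRight hq hq' hm) b) =
      hit (dualRight hq hq' hm) (hit (dualLeft hq hq' hn) b) := by
  rw [hit_dualLeft, hit_dualRight, ← LinearMap.comp_apply, ← LinearMap.comp_apply,
    ← TensorProduct.map_comp, ← TensorProduct.map_comp, LinearMap.comp_id, LinearMap.id_comp,
    LinearMap.comp_id, LinearMap.id_comp]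

theorem isNilpotent_hit_dualLeft : IsNilpotent (hit (dualLeft hq hq' hn)) := by
  refine ⟨n, ?_⟩
  rw [hit_dualLeft, TensorProduct.map_pow, Taft.hit_dualX_pow, TensorProduct.map_zero_left]

theorem isNilpotent_hit_dualRight : IsNilpotent (hit (dualRight hq hq' hm)) := by
  refine ⟨m, ?_⟩
  rw [hit_dualRight, TensorProduct.map_pow, Taft.hit_dualX_pow, TensorProduct.map_zero_right]

/-- Elements killed by both `hit` operators are cocommutative. -/
theorem comm_comul_of_hit_eq_zero [CharZero k] {w : Taft hq' ⊗[k] Taft hq}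
    (h1 : hit (dualLeft hq hq' hn) w = 0) (h2 : hit (dualRight hq hq' hm) w = 0) :
    TensorProduct.comm k _ _ (Coalgebra.comul (R := k) w) = Coalgebra.comul (R := k) w := by
  obtain ⟨Q', hQ'⟩ := Taft.exists_proj_add_comp_hit_dualX hq' hn
  obtain ⟨Q, hQ⟩ := Taft.exists_proj_add_comp_hit_dualX hq hm
  -- The decomposition id = proj + Q ∘ hit on each leg: an element killed by both operators is fixed
  -- by both projections, hence lies in the tensor product of the group algebras.
  have k1 : ∀ v : Taft hq' ⊗[k] Taft hq, v =
      TensorProduct.map (Taft.proj hq').toLinearMap LinearMap.id v +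
        TensorProduct.map Q' LinearMap.id (hit (dualLeft hq hq' hn) v) := by
    intro v
    rw [hit_dualLeft]
    induction v using TensorProduct.induction_on with
    | zero => simp
    | add s t hs ht => rw [map_add, map_add, map_add, add_add_add_comm, ← hs, ← ht]
    | tmul a b =>
      simp only [TensorProduct.map_tmul, LinearMap.id_apply]
      rw [← TensorProduct.add_tmul]
      exact congrArg (· ⊗ₜ[k] b) (LinearMap.congr_fun hQ' a)
  have k2 : ∀ v : Taft hq' ⊗[k] Taft hq, v =
      TensorProduct.map LinearMap.id (Taft.proj hq).toLinearMap v +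
        TensorProduct.map LinearMap.id Q (hit (dualRight hq hq' hm) v) := by
    intro v
    rw [hit_dualRight]
    induction v using TensorProduct.induction_on with
    | zero => simp
    | add s t hs ht => rw [map_add, map_add, map_add, add_add_add_comm, ← hs, ← ht]
    | tmul a b =>
      simp only [TensorProduct.map_tmul, LinearMap.id_apply]
      rw [← TensorProduct.tmul_add]
      exact congrArg (a ⊗ₜ[k] ·) (LinearMap.congr_fun hQ b)
  have e1 := k1 w
  have e2 := k2 w
  rw [h1, map_zero, add_zero] at e1
  rw [h2, map_zero, add_zero] at e2
  rw [e2, e1]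
  clear e1 e2 h1 h2 k1 k2
  induction w using TensorProduct.induction_on with
  | zero => simp
  | add s t hs ht => simp only [map_add, hs, ht]
  | tmul a b => exact comm_comul_tmul (Taft.comm_comul_proj hq' a) (Taft.comm_comul_proj hq b)

/-- For a cocommutative element, evaluating F on the left leg is the same as on the right leg, so
`hit F w = 0` also gives information from the left. -/
theorem lid_rTensor_comul_of_comm {C : Type*} [AddCommGroup C] [Module k C] [Coalgebra k C] (F : C →ₗ[k] k)
    {w : C} (hw : TensorProduct.comm k _ _ (Coalgebra.comul (R := k) w) =
      Coalgebra.comul (R := k) w) :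
    TensorProduct.lid k C (F.rTensor C (Coalgebra.comul w)) = hit F w := by
  rw [hit_apply]
  nth_rewrite 1 [← hw]
  induction Coalgebra.comul (R := k) w using TensorProduct.induction_on with
  | zero => simp
  | add s t hs ht => simp only [map_add, hs, ht]
  | tmul a b => simp

theorem comul_X_tmul_one : Coalgebra.comul (R := k) (Taft.x hq' ⊗ₜ[k] (1 : Taft hq)) =
    (Taft.x hq' ⊗ₜ[k] (1 : Taft hq)) ⊗ₜ[k] (Taft.h hq' ⊗ₜ[k] (1 : Taft hq)) +
      1 ⊗ₜ[k] (Taft.x hq' ⊗ₜ[k] (1 : Taft hq)) := by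
  rw [TensorProduct.comul_tmul, Taft.comul_x, Bialgebra.comul_one, Algebra.TensorProduct.one_def,
    TensorProduct.add_tmul, map_add]
  rfl

theorem comul_one_tmul_x : Coalgebra.comul (R := k) ((1 : Taft hq') ⊗ₜ[k] Taft.x hq) =
    ((1 : Taft hq') ⊗ₜ[k] Taft.x hq) ⊗ₜ[k] ((1 : Taft hq') ⊗ₜ[k] Taft.h hq) +
      1 ⊗ₜ[k] ((1 : Taft hq') ⊗ₜ[k] Taft.x hq) := by
  rw [TensorProduct.comul_tmul, Taft.comul_x, Bialgebra.comul_one, Algebra.TensorProduct.one_def,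
    TensorProduct.tmul_add, map_add]
  rfl

theorem dualLeft_one : dualLeft hq hq' hn 1 = 0 := by
  simp [dualLeft, Algebra.TensorProduct.one_def, Taft.dualX_one]

theorem dualRight_one : dualRight hq hq' hm 1 = 0 := by
  simp [dualRight, Algebra.TensorProduct.one_def, Taft.dualX_one]

theorem hit_of_comul_eq_skew {C : Type*} [Ring C] [Bialgebra k C] (F : C →ₗ[k] k) {y g : C}
    (hy : Coalgebra.comul (R := k) y = y ⊗ₜ g + 1 ⊗ₜ y) : hit F y = F g • y + F y • 1 := by
  simp [hit_apply, hy]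

/-- The skew primitive elements of a tensor product of two Taft algebras. -/
theorem skew_primitive [CharZero k] (hm : m ≠ 1) (hn : n ≠ 1) {y g : Taft hq' ⊗[k] Taft hq}
    (hg : Coalgebra.comul (R := k) g = g ⊗ₜ g) (hg0 : g ≠ 0) (hg1 : g ≠ 1)
    (hy : Coalgebra.comul (R := k) y = y ⊗ₜ g + 1 ⊗ₜ y) :
    ∃ c d e : k, y = c • (Taft.x hq' ⊗ₜ 1) + d • (1 ⊗ₜ Taft.x hq) + e • (g - 1) ∧
      (c ≠ 0 → g = Taft.h hq' ⊗ₜ 1) ∧ (d ≠ 0 → g = 1 ⊗ₜ Taft.h hq) := by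
  set F := dualLeft hq hq' hn with hF
  set F' := dualRight hq hq' hm with hF'
  set X : Taft hq' ⊗[k] Taft hq := Taft.x hq' ⊗ₜ 1 with hX
  set x : Taft hq' ⊗[k] Taft hq := 1 ⊗ₜ Taft.x hq with hx
  have hFg : F g = 0 := apply_eq_zero_of_hit_nilpotent (isNilpotent_hit_dualLeft hq hq' hn) hg0 hg
  have hFg' : F' g = 0 :=
    apply_eq_zero_of_hit_nilpotent (isNilpotent_hit_dualRight hq hq' hm) hg0 hg
  have hF1 : F 1 = 0 := dualLeft_one hq hq' hn
  have hF1' : F' 1 = 0 := dualRight_one hq hq' hm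
  have hFX : F X = 1 := by simp [hF, hX, dualLeft, Taft.dualX_x]
  have hFx : F x = 0 := by simp [hF, hx, dualLeft, Taft.dualX_one]
  have hFX' : F' X = 0 := by simp [hF', hX, dualRight, Taft.dualX_one]
  have hFx' : F' x = 1 := by simp [hF', hx, dualRight, Taft.dualX_x]
  have hXH : F (Taft.h hq' ⊗ₜ 1) = 0 := by simp [hF, dualLeft, Taft.dualX_h]
  have hXH' : F' (Taft.h hq' ⊗ₜ 1) = 0 := by simp [hF', dualRight, Taft.dualX_one]
  have hxh : F (1 ⊗ₜ Taft.h hq) = 0 := by simp [hF, dualLeft, Taft.dualX_one]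
  have hxh' : F' (1 ⊗ₜ Taft.h hq) = 0 := by simp [hF', dualRight, Taft.dualX_h]
  have cX := comul_X_tmul_one hq hq'
  have cx := comul_one_tmul_x hq hq'
  rw [← hX] at cX
  rw [← hx] at cx
  -- As F and F' vanish on g, the operators send y to the scalars F y and F' y; subtracting these
  -- multiples of X and x leaves an element killed by both.
  set w := y - F y • X - F' y • x with hw
  have hw1 : hit F w = 0 := by
    simp [hw, hit_of_comul_eq_skew F hy, hit_of_comul_eq_skew F cX, hit_of_comul_eq_skew F cx,
      hFg, hFX, hFx, hXH, hxh]
  have hw2 : hit F' w = 0 := by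
    simp [hw, hit_of_comul_eq_skew F' hy, hit_of_comul_eq_skew F' cX, hit_of_comul_eq_skew F' cx,
      hFg', hFX', hFx', hXH', hxh']
  have hwc := comm_comul_of_hit_eq_zero hq hq' hm hn hw1 hw2
  have hyw : y = F y • X + F' y • x + w := by rw [hw]; abel
  have hc : F y ≠ 0 → g = Taft.h hq' ⊗ₜ 1 := by
    intro h0
    -- Evaluating F on the left leg turns the decomposition of y into F(y)·g = F(y)·H, because F(1)
    -- = 0 and w contributes nothing.
    have e := congrArg (fun b => TensorProduct.lid k _ (F.rTensor _ (Coalgebra.comul (R := k) b)))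
      hyw
    simp only [map_add, map_smul, lid_rTensor_comul_of_comm F hwc, hw1, hy, cX, cx] at e
    simpa [hF1, hFX, hFx, h0] using e
  have hd : F' y ≠ 0 → g = 1 ⊗ₜ Taft.h hq := by
    intro h0
    have e := congrArg (fun b => TensorProduct.lid k _ (F'.rTensor _ (Coalgebra.comul (R := k) b)))
      hyw
    simp only [map_add, map_smul, lid_rTensor_comul_of_comm F' hwc, hw2, hy, cX, cx] at e
    simpa [hF1', hFX', hFx', h0] using e
  have hcw : Coalgebra.comul (R := k) w = w ⊗ₜ g + 1 ⊗ₜ w := by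
    have e1 : F y • Coalgebra.comul (R := k) X = F y • (X ⊗ₜ g + 1 ⊗ₜ X) := by
      by_cases h0 : F y = 0
      · simp [h0]
      · rw [cX, ← hc h0]
    have e2 : F' y • Coalgebra.comul (R := k) x = F' y • (x ⊗ₜ g + 1 ⊗ₜ x) := by
      by_cases h0 : F' y = 0
      · simp [h0]
      · rw [cx, ← hd h0]
    rw [hw, map_sub, map_sub, map_smul, map_smul, e1, e2, hy]
    simp only [TensorProduct.sub_tmul, TensorProduct.tmul_sub, TensorProduct.smul_tmul',
      TensorProduct.tmul_smul, smul_add]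
    abel
  -- Now w is both skew primitive and cocommutative: w ⊗ g + 1 ⊗ w = g ⊗ w + w ⊗ 1. Applying ℓ to
  -- the left leg forces w to be a multiple of g - 1.
  obtain ⟨ℓ, hℓ⟩ : ∃ ℓ : (Taft hq' ⊗[k] Taft hq) →ₗ[k] k, ℓ (g - 1) = 1 :=
    Module.Projective.exists_dual_eq_one k (sub_ne_zero.2 hg1)
  refine ⟨F y, F' y, ℓ w, ?_, hc, hd⟩
  have e := hwc
  rw [hcw] at e
  have e' := congrArg (fun t => TensorProduct.lid k _ (ℓ.rTensor _ t)) e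
  simp only [map_add, TensorProduct.comm_tmul, LinearMap.rTensor_tmul, TensorProduct.lid_tmul]
    at e'
  rw [map_sub] at hℓ
  have hwe : w = ℓ w • (g - 1) := by
    clear_value w
    calc w = (ℓ g - ℓ 1) • w := by rw [hℓ, one_smul]
      _ = ℓ w • (g - 1) := by
        rw [sub_smul, smul_sub, sub_eq_sub_iff_add_eq_add, e']
  rw [← hwe]
  exact hyw

/-- The two hit operators commute, yet applied to z in one order they give 0 and in the other c·1.
This later identifies the two commutation scalars, of h with X and of x with H. -/
theorem skew_cross_term_eq_zero (hm : m ≠ 1) (hn : n ≠ 1) {z g : Taft hq' ⊗[k] Taft hq} {c : k}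
    (hg : Coalgebra.comul (R := k) g = g ⊗ₜ g) (hg0 : g ≠ 0)
    (hz : Coalgebra.comul (R := k) z = z ⊗ₜ g + 1 ⊗ₜ z +
      c • ((Taft.x hq' ⊗ₜ[k] (1 : Taft hq)) ⊗ₜ[k] (Taft.h hq' ⊗ₜ[k] Taft.x hq))) : c = 0 := by
  have hFg : dualLeft hq hq' hn g = 0 :=
    apply_eq_zero_of_hit_nilpotent (isNilpotent_hit_dualLeft hq hq' hn) hg0 hg
  have hFg' : dualRight hq hq' hm g = 0 :=
    apply_eq_zero_of_hit_nilpotent (isNilpotent_hit_dualRight hq hq' hm) hg0 hg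
  have e1 : hit (dualLeft hq hq' hn) z = dualLeft hq hq' hn z • 1 := by
    have hHx : dualLeft hq hq' hn (Taft.h hq' ⊗ₜ Taft.x hq) = 0 := by
      simp [dualLeft, Taft.counit_x]
    rw [hit_apply, hz]
    simp [hFg, hHx]
  have e2 : hit (dualRight hq hq' hm) z =
      dualRight hq hq' hm z • 1 + c • (Taft.x hq' ⊗ₜ 1) := by
    have hHx : dualRight hq hq' hm (Taft.h hq' ⊗ₜ Taft.x hq) = 1 := by
      simp [dualRight, Taft.counit_h, Taft.dualX_x]
    rw [hit_apply, hz]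
    simp [hFg', hHx]
  have h1 : hit (dualLeft hq hq' hn) 1 = 0 := by
    rw [hit_dualLeft, Algebra.TensorProduct.one_def, TensorProduct.map_tmul, Taft.hit_dualX_one,
      TensorProduct.zero_tmul]
  have h2 : hit (dualRight hq hq' hm) 1 = 0 := by
    rw [hit_dualRight, Algebra.TensorProduct.one_def, TensorProduct.map_tmul, Taft.hit_dualX_one,
      TensorProduct.tmul_zero]
  have h3 : hit (dualLeft hq hq' hn) (Taft.x hq' ⊗ₜ 1) = 1 := by
    have := Taft.hit_dualX_mul_x hq' hn 1
    rw [one_mul, Taft.hit_dualX_one, zero_mul, smul_zero, zero_add] at this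
    rw [hit_dualLeft, TensorProduct.map_tmul, this, LinearMap.id_apply,
      Algebra.TensorProduct.one_def]
  have e := hit_dualLeft_hit_dualRight hq hq' hm hn z
  rw [e1, e2, map_add, map_smul, map_smul, map_smul, h1, h2, h3, smul_zero, smul_zero,
    zero_add] at e
  have e' := congrArg (Coalgebra.counit (R := k)) e
  simpa using e'

end SkewPrimitive

/-! ### Skew derivations and commutation of x^m with X. -/

namespace Taft

variable {k : Type*} [Field k] {n : ℕ} {q : k} (hq : IsPrimitiveRoot q n)

theorem scale_h_mul (c : k) (a : Taft hq) : scale hq c (h hq * a) = h hq * scale hq c a := by simp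

theorem scale_x_mul (c : k) (a : Taft hq) :
    scale hq c (x hq * a) = c • (x hq * scale hq c a) := by simp

/-- The algebra endomorphism `h ↦ c h`, `x ↦ c x`. -/
noncomputable def rescale {c : k} (hc : c ^ n = 1) : Taft hq →ₐ[k] Taft hq :=
  lift hq (c • h hq) (c • x hq) (by rw [smul_pow, hc, h_pow, one_smul])
    (by rw [smul_pow, x_pow, smul_zero])
    (by rw [smul_mul_smul, x_mul_h, smul_mul_smul, smul_comm])

theorem rescale_h_mul {c : k} (hc : c ^ n = 1) (a : Taft hq) :
    rescale hq hc (h hq * a) = c • (h hq * rescale hq hc a) := by simp [rescale]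

theorem rescale_x_mul {c : k} (hc : c ^ n = 1) (a : Taft hq) :
    rescale hq hc (x hq * a) = c • (x hq * rescale hq hc a) := by simp [rescale]

variable [NeZero n]

/-- Existence of skew derivations of the Taft algebra. -/
theorem exists_skewDerivation (hn : n ≠ 1) {c : k} (hc : c ^ n = 1) (d : k) (y : Taft hq)
    {r : k} (hr : IsPrimitiveRoot r n)
    (h1 : y * h hq = (q * c) • (h hq * y))
    (h2 : c • (x hq * y) = (r * d) • (y * x hq)) :
    ∃ δ : Taft hq →ₗ[k] Taft hq, δ 1 = 0 ∧ (∀ a, δ (h hq * a) = c • (h hq * δ a)) ∧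
      ∀ a, δ (x hq * a) = c • (x hq * δ a) + y * scale hq d a := by
  -- The derivation is the off-diagonal entry of a triangular representation whose diagonal entries
  -- are the two twisting endomorphisms. Its nth power relation for x holds because the strictly
  -- triangular and the diagonal parts r-commute, which is what `h2` says.
  let M : Taft hq →ₐ[k] Matrix (Fin 2) (Fin 2) (Taft hq) :=
    lift hq (Matrix.diagonal ![c • h hq, h hq])
      (!![0, y; 0, 0] + Matrix.diagonal ![c • x hq, d • x hq])
      (by
        rw [Matrix.diagonal_pow, ← Matrix.diagonal_one]
        congr 1
        ext i
        fin_cases i <;> simp [h_pow, smul_pow, hc])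
      (by
        refine add_pow_eq_zero_of_qcomm hr ?_ ?_ ?_
        · ext i j
          fin_cases i <;> fin_cases j <;> simp [smul_smul, h2, Matrix.vecMul_diagonal]
        · have h0 := NeZero.ne n
          have h2 : (!![0, y; 0, 0] : Matrix (Fin 2) (Fin 2) (Taft hq)) ^ 2 = 0 := by
            ext i j; fin_cases i <;> fin_cases j <;> simp [pow_two]
          have hn' : n = n - 2 + 2 := by omega
          rw [congrArg ((!![0, y; 0, 0] : Matrix (Fin 2) (Fin 2) (Taft hq)) ^ ·) hn', pow_add, h2,
            mul_zero]
        · rw [Matrix.diagonal_pow, ← Matrix.diagonal_zero]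
          congr 1
          ext i
          fin_cases i <;> simp [x_pow, smul_pow])
      (by
        ext i j
        fin_cases i <;> fin_cases j <;> simp [x_mul_h, h1, smul_smul, mul_comm, mul_left_comm])
  have hM1 : ∀ a, M a 1 1 = scale hq d a := by
    intro a
    refine LinearMap.congr_fun (f := Matrix.entryLinearMap k (Taft hq) 1 1 ∘ₗ M.toLinearMap)
      (g := (scale hq d).toLinearMap) (linearMap_ext_of_mul hq ?_ ?_ ?_) a
    · simp
    · intro a ha
      simp at ha ⊢
      simp [M, Matrix.mul_apply, Fin.sum_univ_two]
      exact congrArg _ ha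
    · intro a ha
      simp at ha ⊢
      simp [M, Matrix.mul_apply, Fin.sum_univ_two]
      exact congrArg _ (congrArg _ ha)
  refine ⟨Matrix.entryLinearMap k (Taft hq) 0 1 ∘ₗ M.toLinearMap, by simp, fun a => ?_,
    fun a => ?_⟩
  · simp only [LinearMap.comp_apply, AlgHom.toLinearMap_apply, Matrix.entryLinearMap_apply]
    simp [M, Matrix.mul_apply, Fin.sum_univ_two]
  · rw [← hM1]
    simp only [LinearMap.comp_apply, AlgHom.toLinearMap_apply, Matrix.entryLinearMap_apply]
    simp [M, Matrix.mul_apply, Fin.sum_univ_two]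

end Taft

/-- The closed form exposes the q-integer [i + 1] as a factor of the correction term, so the
correction disappears at exponent m. -/
theorem pow_mul_of_qcomm_skew {k B : Type*} [Field k] [Ring B] [Algebra k B] {q α : k}
    {h x H X : B} (hxh : x * h = q • (h * x)) (hxH : x * H = q • (H * x))
    (hxX : x * X = q • (X * x) + α • (1 - H * h)) (i : ℕ) :
    x ^ (i + 1) * X = q ^ (i + 1) • (X * x ^ (i + 1)) +
      (α * ∑ j ∈ Finset.range (i + 1), q ^ j) • ((1 - q ^ i • (H * h)) * x ^ i) := by
  have hxg : x * (H * h) = (q * q) • (H * h * x) := by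
    rw [← mul_assoc, hxH, smul_mul_assoc, mul_assoc, hxh, mul_smul_comm, smul_smul, mul_assoc]
  induction i with
  | zero => simp [hxX]
  | succ i ih =>
    have e : x * ((1 - q ^ i • (H * h)) * x ^ i) =
        x ^ (i + 1) - q ^ (i + 2) • (H * h * x ^ (i + 1)) := by
      rw [← mul_assoc, mul_sub, mul_one, mul_smul_comm, hxg, sub_mul, smul_smul, smul_mul_assoc,
        mul_assoc _ x, ← pow_succ']
      ring_nf
    rw [pow_succ', mul_assoc, ih, mul_add, mul_smul_comm, mul_smul_comm, e, ← mul_assoc x X, hxX,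
      add_mul, smul_mul_assoc, smul_mul_assoc, mul_assoc X x, ← pow_succ',
      Finset.sum_range_succ _ (i + 1), sub_mul, sub_mul, one_mul, smul_mul_assoc]
    have hS := geom_sum_mul q (i + 1)
    match_scalars <;> first | ring1 | linear_combination (-(α * q ^ (i + 1)) * hS)

theorem pow_mul_comm_of_skew {k B : Type*} [Field k] [Ring B] [Algebra k B] {m : ℕ} {q σ α : k}
    (hm : m ≠ 1) (hq : IsPrimitiveRoot q m) (hσ : σ ^ m = 1) (hα : α = 0 ∨ σ = q) {h x H X : B}
    (hxh : x * h = q • (h * x)) (hxH : x * H = σ • (H * x))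
    (hxX : x * X = σ • (X * x) + α • (1 - H * h)) : x ^ m * X = X * x ^ m := by
  rcases m with _ | m
  · simp
  rcases hα with rfl | rfl
  · rw [zero_smul, add_zero] at hxX
    have : ∀ i : ℕ, x ^ i * X = σ ^ i • (X * x ^ i) := by
      intro i
      induction i with
      | zero => simp
      | succ i ih =>
        rw [pow_succ, mul_assoc, hxX, mul_smul_comm, ← mul_assoc, ih, smul_mul_assoc, smul_smul,
          mul_assoc, pow_succ']
    rw [this, hσ, one_smul]
  · have h1 : σ ≠ 1 := hq.ne_one (by omega)
    rw [pow_mul_of_qcomm_skew hxh hxH hxX, hσ, one_smul, geom_sum_eq h1, hσ, sub_self, zero_div,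
      mul_zero, zero_smul, add_zero]

theorem Taft.scale_one {k : Type*} [Field k] {n : ℕ} {q : k} (hq : IsPrimitiveRoot q n)
    (a : Taft hq) : scale hq 1 a = a := by
  have : scale hq 1 = AlgHom.id k _ := by apply algHom_ext <;> simp
  rw [this, AlgHom.id_apply]

/-! ### The model on the tensor product, showing that the presentation does not collapse. -/

section action

variable {k : Type*} [Field k] {m n : ℕ} {q q' σ α : k}
  (hq : IsPrimitiveRoot q m) (hq' : IsPrimitiveRoot q' n)

theorem exists_action_derivations [NeZero n] (hq : IsPrimitiveRoot q m) (hn : n ≠ 1) (hσn : σ ^ n = 1)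
    (hα : α = 0 ∨ (m = n ∧ σ = q ∧ q' * q = 1)) :
    ∃ δ₁ δ₂ : Taft hq' →ₗ[k] Taft hq',
      (δ₁ 1 = 0 ∧ (∀ a, δ₁ (Taft.h hq' * a) = σ • (Taft.h hq' * δ₁ a)) ∧
        ∀ a, δ₁ (Taft.x hq' * a) = σ • (Taft.x hq' * δ₁ a) + α • a) ∧
      (δ₂ 1 = 0 ∧ (∀ a, δ₂ (Taft.h hq' * a) = σ • (Taft.h hq' * δ₂ a)) ∧
        ∀ a, δ₂ (Taft.x hq' * a) =
          σ • (Taft.x hq' * δ₂ a) - α • (Taft.h hq' * Taft.scale hq' σ a)) := by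
  rcases hα with rfl | ⟨rfl, rfl, hqq⟩
  · exact ⟨0, 0, by simp, by simp⟩
  -- The values at X are read off from xX = σXx + α - αHh: δ₁(X) = α and δ₂(X) = -αH.
  · obtain ⟨δ₁, h1, h2, h3⟩ := Taft.exists_skewDerivation hq' hn hσn 1 (α • 1)
      hq (by simp [hqq]) (by simp [smul_smul])
    obtain ⟨δ₂, h1', h2', h3'⟩ := Taft.exists_skewDerivation hq' hn hσn σ (-(α • Taft.h hq'))
      hq'
      (by simp [hqq]) (by
        simp only [mul_neg, neg_mul, smul_mul_assoc, mul_smul_comm, Taft.x_mul_h, smul_neg,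
          smul_smul]
        ring_nf)
    refine ⟨δ₁, δ₂, ⟨h1, h2, fun a => ?_⟩, h1', h2', fun a => ?_⟩
    · rw [h3, Taft.scale_one, smul_mul_assoc, one_mul]
    · rw [h3', neg_mul, smul_mul_assoc, sub_eq_add_neg]

/-- The relations hold for suitable operators on `Taft hq' ⊗ Taft hq`, where `H`, `X` act by left
multiplication and `h`, `x` act by the commutation rules. -/
theorem exists_action [NeZero m] [NeZero n] (hm : m ≠ 1) (hn : n ≠ 1) (hσm : σ ^ m = 1) (hσn : σ ^ n = 1)
    (hα : α = 0 ∨ (m = n ∧ σ = q ∧ q' * q = 1)) :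
    ∃ Oh Ox OH OX : Module.End k (Taft hq' ⊗[k] Taft hq),
      TwoTaftRelations m n q q' σ α Oh Ox OH OX ∧
      (∀ a l, OH (a ⊗ₜ l) = (Taft.h hq' * a) ⊗ₜ l) ∧
      (∀ a l, OX (a ⊗ₜ l) = (Taft.x hq' * a) ⊗ₜ l) ∧
      (∀ l, Oh (1 ⊗ₜ l) = 1 ⊗ₜ (Taft.h hq * l)) ∧
      ∀ l, Ox (1 ⊗ₜ l) = 1 ⊗ₜ (Taft.x hq * l) := by
  obtain ⟨δ₁, δ₂, ⟨d1, dH, dX⟩, d1', dH', dX'⟩ := exists_action_derivations hq' hq hn hσn hα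
  have hασ : α * q = α * σ := by
    rcases hα with rfl | ⟨-, rfl, -⟩
    · simp
    · rfl
  set φ := Taft.scale hq' σ with hφ
  set ψ := Taft.rescale hq' hσn with hψ
  have hφψ : ∀ a, ψ (φ a) = φ (ψ a) := by
    have : ψ.comp φ = φ.comp ψ := by
      apply Taft.algHom_ext <;> simp [hφ, hψ, Taft.rescale]
    exact fun a => DFunLike.congr_fun this a
  -- Needed for xh = qhx. Each derivation lowers the X-degree by one, so commuting it past φ costs a
  -- factor σ, which is q whenever α ≠ 0.
  have hδφ : ∀ a, δ₁ (φ a) = q • φ (δ₁ a) := by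
    refine fun a => LinearMap.congr_fun (f := δ₁ ∘ₗ φ.toLinearMap) (g := q • (φ.toLinearMap ∘ₗ δ₁))
      (Taft.linearMap_ext_of_mul hq' ?_ ?_ ?_) a
    · simp [d1]
    · intro a ha
      simp only [LinearMap.comp_apply, LinearMap.smul_apply, AlgHom.toLinearMap_apply] at ha ⊢
      rw [hφ, Taft.scale_h_mul, dH, dH, map_smul, Taft.scale_h_mul, ← hφ, ha, mul_smul_comm,
        smul_comm]
    · intro a ha
      simp only [LinearMap.comp_apply, LinearMap.smul_apply, AlgHom.toLinearMap_apply] at ha ⊢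
      rw [hφ, Taft.scale_x_mul, map_smul, dX, dX, map_add, map_smul, map_smul, Taft.scale_x_mul,
        ← hφ, ha, mul_smul_comm, smul_add, smul_add, smul_smul _ α, smul_smul _ α, mul_comm q,
        hασ, mul_comm α]
      congr 1
      simp only [smul_smul]
      ring_nf
  have hδφ' : ∀ a, δ₂ (φ a) = q • φ (δ₂ a) := by
    refine fun a => LinearMap.congr_fun (f := δ₂ ∘ₗ φ.toLinearMap) (g := q • (φ.toLinearMap ∘ₗ δ₂))
      (Taft.linearMap_ext_of_mul hq' ?_ ?_ ?_) a
    · simp [d1']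
    · intro a ha
      simp only [LinearMap.comp_apply, LinearMap.smul_apply, AlgHom.toLinearMap_apply] at ha ⊢
      rw [hφ, Taft.scale_h_mul, dH', dH', map_smul, Taft.scale_h_mul, ← hφ, ha, mul_smul_comm,
        smul_comm]
    · intro a ha
      simp only [LinearMap.comp_apply, LinearMap.smul_apply, AlgHom.toLinearMap_apply] at ha ⊢
      rw [hφ, Taft.scale_x_mul, map_smul, dX', dX', map_sub, map_smul, map_smul, Taft.scale_x_mul,
        Taft.scale_h_mul, ← hφ, ha, mul_smul_comm, smul_sub, smul_sub, smul_smul _ α,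
        smul_smul _ α, mul_comm q, hασ, mul_comm α]
      congr 1
      simp only [smul_smul]
      ring_nf
  set Oh : Module.End k (Taft hq' ⊗[k] Taft hq) :=
    TensorProduct.map φ.toLinearMap (LinearMap.mulLeft k (Taft.h hq)) with hOh
  -- This encodes the normal form x·a = ψ(a)x + δ₁(a) + δ₂(a)h of moving x to the right past an
  -- element a of the first factor.
  set Ox : Module.End k (Taft hq' ⊗[k] Taft hq) :=
    TensorProduct.map ψ.toLinearMap (LinearMap.mulLeft k (Taft.x hq)) +
      TensorProduct.map δ₁ LinearMap.id + TensorProduct.map δ₂ (LinearMap.mulLeft k (Taft.h hq))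
    with hOx
  set OH : Module.End k (Taft hq' ⊗[k] Taft hq) :=
    TensorProduct.map (LinearMap.mulLeft k (Taft.h hq')) LinearMap.id with hOH
  set OX : Module.End k (Taft hq' ⊗[k] Taft hq) :=
    TensorProduct.map (LinearMap.mulLeft k (Taft.x hq')) LinearMap.id with hOX
  have eh : ∀ a l, Oh (a ⊗ₜ l) = φ a ⊗ₜ (Taft.h hq * l) := fun a l => by simp [hOh]
  have ex : ∀ a l, Ox (a ⊗ₜ l) = ψ a ⊗ₜ (Taft.x hq * l) + δ₁ a ⊗ₜ l + δ₂ a ⊗ₜ (Taft.h hq * l) :=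
    fun a l => by simp [hOx]
  have eH : ∀ a l, OH (a ⊗ₜ l) = (Taft.h hq' * a) ⊗ₜ l := fun a l => by simp [hOH]
  have eX : ∀ a l, OX (a ⊗ₜ l) = (Taft.x hq' * a) ⊗ₜ l := fun a l => by simp [hOX]
  clear_value Oh Ox OH OX
  have ex1 : ∀ l, Ox (1 ⊗ₜ l) = 1 ⊗ₜ (Taft.x hq * l) := fun l => by simp [ex, d1, d1']
  have eh1 : ∀ l, Oh (1 ⊗ₜ l) = 1 ⊗ₜ (Taft.h hq * l) := fun l => by simp [eh]
  have hxh : Ox * Oh = q • (Oh * Ox) := by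
    refine TensorProduct.ext' fun a l => ?_
    simp only [Module.End.mul_apply, LinearMap.smul_apply, eh, ex, map_add, hφψ, hδφ, hδφ',
      smul_add]
    rw [← mul_assoc, Taft.x_mul_h, smul_mul_assoc, TensorProduct.tmul_smul, mul_assoc,
      TensorProduct.smul_tmul', TensorProduct.smul_tmul', TensorProduct.smul_tmul']
  have hxH : Ox * OH = σ • (OH * Ox) := by
    refine TensorProduct.ext' fun a l => ?_
    simp only [Module.End.mul_apply, LinearMap.smul_apply, eH, ex, map_add, dH, dH', hψ,
      Taft.rescale_h_mul, smul_add, TensorProduct.smul_tmul']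
  have hxX : Ox * OX - σ • (OX * Ox) = α • (1 - OH * Oh) := by
    refine TensorProduct.ext' fun a l => ?_
    simp only [Module.End.mul_apply, LinearMap.smul_apply, LinearMap.sub_apply,
      Module.End.one_apply, eX, eh, eH, ex, map_add, dX, dX', hψ,
      Taft.rescale_x_mul, smul_add, smul_sub, ← TensorProduct.smul_tmul', TensorProduct.add_tmul,
      TensorProduct.sub_tmul]
    abel
  have hxX' : Ox * OX = σ • (OX * Ox) + α • (1 - OH * Oh) := by rw [← hxX]; abel
  refine ⟨Oh, Ox, OH, OX, ⟨?_, ?_, ?_, ?_, hxh, ?_, hxH, ?_, hxX, ?_⟩, eH, eX, eh1, ex1⟩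
  · have h1 : ∀ i a l, (Oh ^ i) (a ⊗ₜ l) = (φ.toLinearMap ^ i) a ⊗ₜ (Taft.h hq ^ i * l) := by
      intro i
      induction i with
      | zero => simp
      | succ i ih =>
        intro a l
        rw [pow_succ, Module.End.mul_apply, eh, ih, pow_succ (Taft.h hq), mul_assoc, pow_succ,
          Module.End.mul_apply, AlgHom.toLinearMap_apply]
    have h2 : φ.toLinearMap ^ m = 1 := by
      refine Taft.linearMap_ext_monomial hq' fun i j => ?_
      rw [hφ, Taft.scale_pow_monomial, ← pow_mul, mul_comm, pow_mul, hσm, one_pow, one_smul,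
        Module.End.one_apply]
    refine TensorProduct.ext' fun a l => ?_
    rw [h1, h2, Taft.h_pow, one_mul]
    rfl
  · have h1 : ∀ i a l, (OH ^ i) (a ⊗ₜ l) = (Taft.h hq' ^ i * a) ⊗ₜ l := by
      intro i
      induction i with
      | zero => simp
      | succ i ih =>
        intro a l
        rw [pow_succ, Module.End.mul_apply, eH, ih, pow_succ (Taft.h hq'), mul_assoc]
    refine TensorProduct.ext' fun a l => ?_
    rw [h1, Taft.h_pow, one_mul]
    rfl
  -- The mth power of the operator x is not computed directly: it commutes with H and X, which
  -- generate everything from the vectors 1 ⊗ l, and it kills those.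
  · have hcX := pow_mul_comm_of_skew hm hq hσm (hα.imp_right fun h => h.2.1) hxh hxH hxX'
    have hcH : Ox ^ m * OH = OH * Ox ^ m := by
      refine pow_mul_comm_of_skew (α := 0) hm hq hσm (Or.inl rfl) hxh hxH ?_
      rw [hxH, zero_smul, add_zero]
    have h1 : ∀ i l, (Ox ^ i) (1 ⊗ₜ l) = 1 ⊗ₜ (Taft.x hq ^ i * l) := by
      intro i
      induction i with
      | zero => simp
      | succ i ih =>
        intro l
        rw [pow_succ, Module.End.mul_apply, ex1, ih, pow_succ (Taft.x hq), mul_assoc]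
    have h2 : TensorProduct.curry (Ox ^ m) = 0 := by
      apply Taft.linearMap_ext_of_mul
      · ext l
        simp [h1, Taft.x_pow]
      · intro a ha
        ext l
        have := LinearMap.congr_fun ha l
        rw [TensorProduct.curry_apply, LinearMap.zero_apply, LinearMap.zero_apply] at this ⊢
        rw [← eH, ← Module.End.mul_apply, hcH, Module.End.mul_apply, this, map_zero]
      · intro a ha
        ext l
        have := LinearMap.congr_fun ha l
        rw [TensorProduct.curry_apply, LinearMap.zero_apply, LinearMap.zero_apply] at this ⊢
        rw [← eX, ← Module.End.mul_apply, hcX, Module.End.mul_apply, this, map_zero]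
    exact TensorProduct.ext h2
  · have h1 : ∀ i a l, (OX ^ i) (a ⊗ₜ l) = (Taft.x hq' ^ i * a) ⊗ₜ l := by
      intro i
      induction i with
      | zero => simp
      | succ i ih =>
        intro a l
        rw [pow_succ, Module.End.mul_apply, eX, ih, pow_succ (Taft.x hq'), mul_assoc]
    refine TensorProduct.ext' fun a l => ?_
    rw [h1, Taft.x_pow, zero_mul, TensorProduct.zero_tmul]
    rfl
  · refine TensorProduct.ext' fun a l => ?_
    rw [LinearMap.smul_apply, Module.End.mul_apply, Module.End.mul_apply, eH, eX, eX, eH,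
      ← mul_assoc, ← mul_assoc, Taft.x_mul_h, smul_mul_assoc, TensorProduct.smul_tmul']
  · refine TensorProduct.ext' fun a l => ?_
    rw [LinearMap.smul_apply, Module.End.mul_apply, Module.End.mul_apply, eh, eX, eX, eh, hφ,
      Taft.scale_x_mul, TensorProduct.smul_tmul']
  · refine TensorProduct.ext' fun a l => ?_
    rw [Module.End.mul_apply, Module.End.mul_apply, eh, eH, eH, eh, hφ, Taft.scale_h_mul]

end action


/-- A bialgebra map out of the Taft algebra from images of the generators. -/
theorem Taft.exists_bialgHom {k E : Type*} [Field k] [Ring E] [Bialgebra k E] {m : ℕ} [NeZero m]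
    {q : k} (hq : IsPrimitiveRoot q m) {a b : E} (h1 : a ^ m = 1) (h2 : b ^ m = 0)
    (h3 : b * a = q • (a * b)) (ca : Coalgebra.comul (R := k) a = a ⊗ₜ a)
    (cb : Coalgebra.comul (R := k) b = b ⊗ₜ a + 1 ⊗ₜ b) (ea : Coalgebra.counit (R := k) a = 1)
    (eb : Coalgebra.counit (R := k) b = 0) :
    ∃ i : Taft hq →ₐc[k] E, i (h hq) = a ∧ i (x hq) = b :=
  ⟨BialgHom.ofAlgHom (lift hq a b h1 h2 h3)
    (by apply algHom_ext <;> simp [counit_h, counit_x, ea, eb])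
    (by apply algHom_ext <;> simp [comul_h, comul_x, ca, cb]),
    lift_h hq a b h1 h2 h3, lift_x hq a b h1 h2 h3⟩

/-! ### The presented Hopf algebras factor through the two Taft algebras. -/

namespace TwoTaft

variable {k : Type*} [Field k] {m n : ℕ} {q q' : k}
  (hq' : IsPrimitiveRoot q' n) (hq : IsPrimitiveRoot q m) (σ α : k)

/-- Every element is a combination of products `i a * j l`. -/
theorem mul_map_surjective (i : Taft hq' →ₐ[k] TwoTaft hq' hq σ α)
    (j : Taft hq →ₐ[k] TwoTaft hq' hq σ α)
    (ih : i (Taft.h hq') = H hq' hq σ α) (ix : i (Taft.x hq') = X hq' hq σ α)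
    (jh : j (Taft.h hq) = h hq' hq σ α) (jx : j (Taft.x hq) = x hq' hq σ α) :
    Function.Surjective (LinearMap.mul' k (TwoTaft hq' hq σ α) ∘ₗ
      TensorProduct.map i.toLinearMap j.toLinearMap) := by
  have w := relations hq' hq σ α
  set p := LinearMap.range (LinearMap.mul' k (TwoTaft hq' hq σ α) ∘ₗ
      TensorProduct.map i.toLinearMap j.toLinearMap) with hp
  have hij : ∀ a l, i a * j l ∈ p := fun a l => ⟨a ⊗ₜ l, by simp⟩
  have hle : ∀ g, (∀ a l, g * (i a * j l) ∈ p) → ∀ b ∈ p, g * b ∈ p := by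
    rintro g hg _ ⟨t, rfl⟩
    induction t using TensorProduct.induction_on with
    | zero => simp
    | add s t hs ht => rw [map_add, mul_add]; exact add_mem hs ht
    | tmul a l => simpa using hg a l
  have hHp := hle (H hq' hq σ α) fun a l => by
    rw [← mul_assoc, ← ih, ← map_mul]
    exact hij _ _
  have hXp := hle (X hq' hq σ α) fun a l => by
    rw [← mul_assoc, ← ix, ← map_mul]
    exact hij _ _
  -- For h and x, induction on the first factor a: each commutation relation moves the generator
  -- past the leading H or X of a.
  have hind : ∀ g, (∀ l, g * j l ∈ p) →
      (∀ a, (∀ l, g * (i a * j l) ∈ p) → ∀ l, g * (H hq' hq σ α * (i a * j l)) ∈ p) →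
      (∀ a, (∀ l, g * (i a * j l) ∈ p) → ∀ l, g * (X hq' hq σ α * (i a * j l)) ∈ p) →
      ∀ b ∈ p, g * b ∈ p := by
    intro g h1 hH hX
    suffices ∀ a, a ∈ ⨅ l, p.comap
        (LinearMap.mulLeft k g ∘ₗ LinearMap.mulRight k (j l) ∘ₗ i.toLinearMap) from
      hle g fun a l => (Submodule.mem_iInf _).1 (this a) l
    refine Taft.left_induction hq' _ ?_ ?_ ?_
    · simpa [Submodule.mem_iInf] using h1
    · intro a ha
      simp only [Submodule.mem_iInf, Submodule.mem_comap, LinearMap.comp_apply,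
        LinearMap.mulLeft_apply, LinearMap.mulRight_apply, AlgHom.toLinearMap_apply, map_mul,
        ih, mul_assoc] at ha ⊢
      exact hH a ha
    · intro a ha
      simp only [Submodule.mem_iInf, Submodule.mem_comap, LinearMap.comp_apply,
        LinearMap.mulLeft_apply, LinearMap.mulRight_apply, AlgHom.toLinearMap_apply, map_mul,
        ix, mul_assoc] at ha ⊢
      exact hX a ha
  have hhp := hind (h hq' hq σ α)
    (fun l => by
      rw [← jh, ← map_mul]
      simpa using hij 1 (Taft.h hq * l))
    (fun a ha l => by
      rw [← mul_assoc, w.h_mul_H, mul_assoc]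
      exact hHp _ (ha l))
    (fun a ha l => by
      rw [← mul_assoc, w.h_mul_X, smul_mul_assoc, mul_assoc]
      exact p.smul_mem _ (hXp _ (ha l)))
  have hxp := hind (x hq' hq σ α)
    (fun l => by
      rw [← jx, ← map_mul]
      simpa using hij 1 (Taft.x hq * l))
    (fun a ha l => by
      rw [← mul_assoc, w.x_mul_H, smul_mul_assoc, mul_assoc]
      exact p.smul_mem _ (hHp _ (ha l)))
    (fun a ha l => by
      have e := w.x_mul_X
      rw [sub_eq_iff_eq_add] at e
      rw [← mul_assoc, e, add_mul, smul_mul_assoc, smul_mul_assoc, sub_mul, one_mul, mul_assoc,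
        mul_assoc]
      exact p.add_mem (p.smul_mem _ (p.sub_mem (hij a l) (hHp _ (hhp _ (hij a l)))))
        (p.smul_mem _ (hXp _ (ha l))))
  intro t
  refine left_ideal_induction (adjoin_gen hq' hq σ α) p (by simpa using hij 1 1) ?_ t
  rintro _ ⟨_ | _, rfl⟩
  exacts [hhp, hxp, hHp, hXp]

variable [NeZero m] [NeZero n]

theorem exists_bialgHom {E : Type*} [Ring E] [Bialgebra k E] {a b c d : E}
    (w : TwoTaftRelations m n q q' σ α a b c d)
    (ca : Coalgebra.comul (R := k) a = a ⊗ₜ a)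
    (cb : Coalgebra.comul (R := k) b = b ⊗ₜ a + 1 ⊗ₜ b)
    (cc : Coalgebra.comul (R := k) c = c ⊗ₜ c)
    (cd : Coalgebra.comul (R := k) d = d ⊗ₜ c + 1 ⊗ₜ d)
    (ea : Coalgebra.counit (R := k) a = 1) (eb : Coalgebra.counit (R := k) b = 0)
    (ec : Coalgebra.counit (R := k) c = 1) (ed : Coalgebra.counit (R := k) d = 0) :
    ∃ f : TwoTaft hq' hq σ α →ₐc[k] E, f (h hq' hq σ α) = a ∧ f (x hq' hq σ α) = b ∧
      f (H hq' hq σ α) = c ∧ f (X hq' hq σ α) = d :=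
  ⟨BialgHom.ofAlgHom (lift hq' hq σ α w)
    (by apply algHom_ext <;> simp [counit_h, counit_x, counit_H, counit_X, ea, eb, ec, ed])
    (by apply algHom_ext <;> simp [comul_h, comul_x, comul_H, comul_X, ca, cb, cc, cd]),
    lift_h hq' hq σ α w, lift_x hq' hq σ α w, lift_H hq' hq σ α w, lift_X hq' hq σ α w⟩

/-- Surjectivity of multiplication holds for any parameters; the conditions on σ and α enter only
through the model, which gives injectivity. -/
theorem factorsThrough (hm : m ≠ 1) (hn : n ≠ 1) (hσm : σ ^ m = 1) (hσn : σ ^ n = 1)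
    (hα : α = 0 ∨ (m = n ∧ σ = q ∧ q' * q = 1)) :
    FactorsThrough k (Taft hq') (Taft hq) (TwoTaft hq' hq σ α) := by
  have w := relations hq' hq σ α
  obtain ⟨i, ih, ix⟩ := Taft.exists_bialgHom hq' w.H_pow w.X_pow w.X_mul_H (comul_H hq' hq σ α)
    (comul_X hq' hq σ α) (counit_H hq' hq σ α) (counit_X hq' hq σ α)
  obtain ⟨j, jh, jx⟩ := Taft.exists_bialgHom hq w.h_pow w.x_pow w.x_mul_h (comul_h hq' hq σ α)
    (comul_x hq' hq σ α) (counit_h hq' hq σ α) (counit_x hq' hq σ α)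
  obtain ⟨Oh, Ox, OH, OX, wO, eH, eX, eh, ex⟩ := exists_action hq hq' hm hn hσm hσn hα
  set ρ := lift hq' hq σ α wO
  have hj : ∀ l, ρ (j l) (1 ⊗ₜ 1) = 1 ⊗ₜ l := by
    refine fun l => LinearMap.congr_fun
      (f := LinearMap.applyₗ (1 ⊗ₜ 1) ∘ₗ ρ.toLinearMap ∘ₗ (j : Taft hq →ₐ[k] _).toLinearMap)
      (g := TensorProduct.mk k (Taft hq') (Taft hq) 1) (Taft.linearMap_ext_of_mul hq ?_ ?_ ?_) l
    · simp
    · intro a ha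
      simp at ha
      simp [jh, ρ, ha, eh]
    · intro a ha
      simp at ha
      simp [jx, ρ, ha, ex]
  have hi : ∀ a l, ρ (i a) (1 ⊗ₜ l) = a ⊗ₜ l := by
    refine fun a l => LinearMap.congr_fun
      (f := LinearMap.applyₗ (1 ⊗ₜ l) ∘ₗ ρ.toLinearMap ∘ₗ (i : Taft hq' →ₐ[k] _).toLinearMap)
      (g := (TensorProduct.mk k (Taft hq') (Taft hq)).flip l)
      (Taft.linearMap_ext_of_mul hq' ?_ ?_ ?_) a
    · simp
    · intro a ha
      simp at ha
      simp [ih, ρ, ha, eH]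
    · intro a ha
      simp at ha
      simp [ix, ρ, ha, eX]
  have hij : ∀ a l, ρ (i a * j l) (1 ⊗ₜ 1) = a ⊗ₜ l := fun a l => by
    rw [map_mul, Module.End.mul_apply, hj, hi]
  have hinj : Function.Injective (LinearMap.mul' k (TwoTaft hq' hq σ α) ∘ₗ
      TensorProduct.map (i : Taft hq' →ₗ[k] _) (j : Taft hq →ₗ[k] _)) := by
    -- Acting on 1 ⊗ 1 recovers a ⊗ l from the product i a * j l.
    refine Function.LeftInverse.injective (g := fun t => ρ t (1 ⊗ₜ 1)) fun t => ?_
    induction t using TensorProduct.induction_on with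
    | zero => simp
    | add s t hs ht => simp only [map_add, LinearMap.add_apply] at hs ht ⊢; rw [hs, ht]
    | tmul a l => simpa using hij a l
  have hsurj := mul_map_surjective hq' hq σ α (i : Taft hq' →ₐ[k] _) (j : Taft hq →ₐ[k] _)
    ih ix jh jx
  refine ⟨i, j, fun a b hab => ?_, fun a b hab => ?_, hinj, hsurj⟩
  · have e : a ⊗ₜ[k] (1 : Taft hq) = b ⊗ₜ[k] (1 : Taft hq) := by rw [← hi, hab, hi]
    simpa using congrArg (fun t => TensorProduct.rid k _ (Coalgebra.counit.lTensor _ t)) e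
  · have e : (1 : Taft hq') ⊗ₜ[k] a = (1 : Taft hq') ⊗ₜ[k] b := by rw [← hj, hab, hj]
    simpa using congrArg (fun t => TensorProduct.lid k _ (Coalgebra.counit.rTensor _ t)) e

end TwoTaft

theorem FactorsThrough.of_bialgEquiv {k A L E E' : Type*} [Field k] [Ring A] [HopfAlgebra k A]
    [Ring L] [HopfAlgebra k L] [Ring E] [HopfAlgebra k E] [Ring E'] [HopfAlgebra k E']
    (h : FactorsThrough k A L E) (e : E' ≃ₐc[k] E) : FactorsThrough k A L E' := by
  obtain ⟨i, j, hi, hj, hb⟩ := h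
  refine ⟨(e.symm : E →ₐc[k] E').comp i, (e.symm : E →ₐc[k] E').comp j,
    e.symm.injective.comp hi, e.symm.injective.comp hj, ?_⟩
  convert e.symm.bijective.comp hb using 1
  funext t
  induction t using TensorProduct.induction_on with
  | zero => simp
  | add s t hs ht => rw [map_add, hs, ht]; simp
  | tmul a l =>
    simp only [LinearMap.comp_apply, TensorProduct.map_tmul, LinearMap.mul'_apply]
    exact (map_mul e.symm _ _).symm


/-! ### Relations forced by a factorization. -/

theorem pow_mul_of_qcomm {k B : Type*} [Field k] [Ring B] [Algebra k B] {c : k} {g y : B}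
    (h : g * y = c • (y * g)) (i : ℕ) : g ^ i * y = c ^ i • (y * g ^ i) := by
  induction i with
  | zero => simp
  | succ i ih =>
    rw [pow_succ, mul_assoc, h, mul_smul_comm, ← mul_assoc, ih, smul_mul_assoc, smul_smul,
      mul_assoc, ← pow_succ, ← pow_succ']

/-- Both y and its conjugate r-commute with u, whereas u - 1 commutes with u; since r ≠ 1, the term
e(u - 1) must vanish. -/
theorem conj_eq_smul_of_qcomm {k B : Type*} [Field k] [Ring B] [Algebra k B] {r c e : k}
    {g g' u u' y : B} (hg : g' * g = 1) (hu : u * u' = 1)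
    (hgu : g * u = u * g) (hg'u : g' * u = u * g') (hr : r ≠ 1) (hyu : y * u = r • (u * y))
    (hy : g * y * g' = c • y + e • (u - 1)) : g * y = c • (y * g) := by
  have h1 : g * y * g' * u = r • (u * (g * y * g')) := by
    rw [mul_assoc, hg'u, ← mul_assoc, mul_assoc g, hyu, mul_smul_comm, smul_mul_assoc,
      ← mul_assoc, ← mul_assoc, hgu, mul_assoc, ← mul_assoc, mul_assoc u, mul_assoc u]
  rw [hy, add_mul, mul_add, smul_mul_assoc, hyu, mul_smul_comm, smul_add, smul_comm r c,
    add_right_inj, smul_mul_assoc, mul_smul_comm, sub_mul, mul_sub, one_mul, mul_one,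
    smul_smul] at h1
  have h2 : (1 - r) • (e • (u - 1)) = 0 := by
    have h3 : (1 - r) • (e • (u * u - u)) = 0 := by
      rw [sub_smul, one_smul, smul_smul, ← h1, sub_self]
    have h4 := congrArg (· * u') h3
    simpa only [smul_mul_assoc, sub_mul, mul_assoc, hu, mul_one, zero_mul] using h4
  rw [(smul_eq_zero.1 h2).resolve_left (sub_ne_zero.2 hr.symm), add_zero] at hy
  calc g * y = g * y * g' * g := by rw [mul_assoc, hg, mul_one]
    _ = c • (y * g) := by rw [hy, smul_mul_assoc]

theorem comul_conj {k E : Type*} [Field k] [Ring E] [Bialgebra k E] {g g' u y : E}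
    (hg : g * g' = 1) (cg : Coalgebra.comul (R := k) g = g ⊗ₜ g)
    (cg' : Coalgebra.comul (R := k) g' = g' ⊗ₜ g')
    (cy : Coalgebra.comul (R := k) y = y ⊗ₜ u + 1 ⊗ₜ y) :
    Coalgebra.comul (R := k) (g * y * g') =
      (g * y * g') ⊗ₜ (g * u * g') + 1 ⊗ₜ (g * y * g') := by
  simp [cg, cg', cy, mul_add, add_mul, hg]

section Forward

variable {k : Type*} [Field k] {m n : ℕ} [NeZero m] [NeZero n] {q q' : k}
  (hq : IsPrimitiveRoot q m) (hq' : IsPrimitiveRoot q' n)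

/-- The character H ↦ q', X ↦ 0, tensored with the counit, separates the two elements because q' ≠
1. -/
theorem h_tmul_one_ne (hn : n ≠ 1) : (Taft.h hq' ⊗ₜ[k] (1 : Taft hq)) ≠ 1 ⊗ₜ Taft.h hq := by
  intro e
  have := congrArg (tensorFunctional (Taft.character hq').toLinearMap Coalgebra.counit) e
  simp [Taft.counit_h] at this
  exact hq'.ne_one (by have := NeZero.ne n; omega) this

theorem h_tmul_h_ne_one (hn : n ≠ 1) : (Taft.h hq' ⊗ₜ[k] Taft.h hq) ≠ 1 := by
  intro e
  rw [Algebra.TensorProduct.one_def] at e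
  have := congrArg (tensorFunctional (Taft.character hq').toLinearMap Coalgebra.counit) e
  simp [Taft.counit_h] at this
  exact hq'.ne_one (by have := NeZero.ne n; omega) this

theorem Taft.h_ne_one (hm : m ≠ 1) : h hq ≠ 1 := by
  intro e
  have := congrArg (character hq) e
  simp at this
  exact hq.ne_one (by have := NeZero.ne m; omega) this

theorem Taft.x_ne_smul (hm : m ≠ 1) (e : k) : x hq ≠ e • (h hq - 1) := by
  intro h
  have := congrArg (dualX hq hm) h
  simp [dualX_x, dualX_h, dualX_one] at this

/-- The coalgebra isomorphism given by a factorization. -/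
theorem FactorsThrough.exists_coalgEquiv {A L E : Type*} [Ring A] [HopfAlgebra k A]
    [Ring L] [HopfAlgebra k L] [Ring E] [HopfAlgebra k E] (i : A →ₐc[k] E) (j : L →ₐc[k] E)
    (hb : Function.Bijective (LinearMap.mul' k E ∘ₗ
      TensorProduct.map (i : A →ₗ[k] E) (j : L →ₗ[k] E))) :
    ∃ Ψ : E ≃ₗc[k] A ⊗[k] L, ∀ a l, Ψ (i a * j l) = a ⊗ₜ l := by
  let Φ : A ⊗[k] L →ₗc[k] E := (Bialgebra.mulCoalgHom k E).comp
    (Coalgebra.TensorProduct.map (i : A →ₗc[k] E) (j : L →ₗc[k] E))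
  have hΦ : Function.Bijective Φ := hb
  refine ⟨(CoalgEquiv.ofBijective hΦ).symm, fun a l => ?_⟩
  exact (CoalgEquiv.ofBijective hΦ).symm_apply_apply (a ⊗ₜ l)

variable {E : Type*} [Ring E] [HopfAlgebra k E]

/-- Ψ need not be multiplicative, but group-likeness and skew primitivity involve only the
comultiplication and the unit element, both of which Ψ preserves. -/
theorem skew_primitive_of_coalgEquiv [CharZero k] (hm : m ≠ 1) (hn : n ≠ 1)
    (i : Taft hq' →ₐc[k] E) (j : Taft hq →ₐc[k] E) (Ψ : E ≃ₗc[k] Taft hq' ⊗[k] Taft hq)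
    (hΨ : ∀ a l, Ψ (i a * j l) = a ⊗ₜ l) {g y : E}
    (hg : Coalgebra.comul (R := k) g = g ⊗ₜ g) (hg0 : g ≠ 0) (hg1 : g ≠ 1)
    (hy : Coalgebra.comul (R := k) y = y ⊗ₜ g + 1 ⊗ₜ y) :
    ∃ c d e : k, y = c • i (Taft.x hq') + d • j (Taft.x hq) + e • (g - 1) ∧
      (c ≠ 0 → g = i (Taft.h hq')) ∧ (d ≠ 0 → g = j (Taft.h hq)) := by
  have h1 : Ψ 1 = 1 := by simpa [Algebra.TensorProduct.one_def] using hΨ 1 1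
  have hi : ∀ a, Ψ (i a) = a ⊗ₜ 1 := fun a => by simpa using hΨ a 1
  have hj : ∀ l, Ψ (j l) = 1 ⊗ₜ l := fun l => by simpa using hΨ 1 l
  have hinj : Function.Injective Ψ := Ψ.injective
  obtain ⟨c, d, e, he, hc, hd⟩ := skew_primitive hq hq' hm hn (g := Ψ g) (y := Ψ y)
    (by rw [← CoalgHomClass.map_comp_comul_apply, hg]; rfl)
    (by rw [← map_zero Ψ]; exact hinj.ne hg0) (by rw [← h1]; exact hinj.ne hg1)
    (by rw [← CoalgHomClass.map_comp_comul_apply, hy, map_add]; rw [← h1]; rfl)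
  refine ⟨c, d, e, hinj ?_, fun h => hinj ?_, fun h => hinj ?_⟩
  · rw [he, map_add, map_add, map_smul, map_smul, map_smul, map_sub, hi, hj, h1]
  · rw [hc h, hi]
  · rw [hd h, hj]

theorem cross_term_eq_zero_of_coalgEquiv (hm : m ≠ 1) (hn : n ≠ 1)
    (i : Taft hq' →ₐc[k] E) (j : Taft hq →ₐc[k] E) (Ψ : E ≃ₗc[k] Taft hq' ⊗[k] Taft hq)
    (hΨ : ∀ a l, Ψ (i a * j l) = a ⊗ₜ l) {g z : E} {c : k}
    (hg : Coalgebra.comul (R := k) g = g ⊗ₜ g) (hg0 : g ≠ 0)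
    (hz : Coalgebra.comul (R := k) z = z ⊗ₜ g + 1 ⊗ₜ z +
      c • (i (Taft.x hq') ⊗ₜ[k] (i (Taft.h hq') * j (Taft.x hq)))) : c = 0 := by
  have h1 : Ψ 1 = 1 := by simpa [Algebra.TensorProduct.one_def] using hΨ 1 1
  have hi : ∀ a, Ψ (i a) = a ⊗ₜ 1 := fun a => by simpa using hΨ a 1
  have hinj : Function.Injective Ψ := Ψ.injective
  refine skew_cross_term_eq_zero hq hq' hm hn (g := Ψ g) (z := Ψ z)
    (by rw [← CoalgHomClass.map_comp_comul_apply, hg]; rfl)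
    (by rw [← map_zero Ψ]; exact hinj.ne hg0) ?_
  rw [← CoalgHomClass.map_comp_comul_apply, hz, map_add, map_add, map_smul, ← hΨ (Taft.h hq') (Taft.x hq), ← hi,
    ← h1]
  rfl

/-- The relations that hold in a Hopf algebra with a factorization. -/
theorem exists_relations_of_coalgEquiv [CharZero k] (hm : m ≠ 1) (hn : n ≠ 1)
    (i : Taft hq' →ₐc[k] E) (j : Taft hq →ₐc[k] E) (Ψ : E ≃ₗc[k] Taft hq' ⊗[k] Taft hq)
    (hΨ : ∀ a l, Ψ (i a * j l) = a ⊗ₜ l) (hi : Function.Injective i)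
    (hj : Function.Injective j) :
    ∃ σ α : k, σ ^ m = 1 ∧ σ ^ n = 1 ∧ (α = 0 ∨ (m = n ∧ σ = q ∧ q' * q = 1)) ∧
      TwoTaftRelations m n q q' σ α (j (Taft.h hq)) (j (Taft.x hq)) (i (Taft.h hq'))
        (i (Taft.x hq')) := by
  have skew := fun {g y : E} => skew_primitive_of_coalgEquiv hq hq' hm hn i j Ψ hΨ (g := g) (y := y)
  have cross := fun {g z : E} {c : k} =>
    cross_term_eq_zero_of_coalgEquiv hq hq' hm hn i j Ψ hΨ (g := g) (z := z) (c := c)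
  have hΨi : ∀ a, Ψ (i a) = a ⊗ₜ 1 := fun a => by simpa using hΨ a 1
  have hΨj : ∀ l, Ψ (j l) = 1 ⊗ₜ l := fun l => by simpa using hΨ 1 l
  have hΨ1 : Ψ 1 = 1 := by simpa [Algebra.TensorProduct.one_def] using hΨ 1 1
  have hHh : i (Taft.h hq') ≠ j (Taft.h hq) := fun e =>
    h_tmul_one_ne hq hq' hn (by rw [← hΨi, e, hΨj])
  have hHh1 : i (Taft.h hq') * j (Taft.h hq) ≠ 1 := fun e =>
    h_tmul_h_ne_one hq hq' hn (by rw [← hΨ, e, hΨ1])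
  have hH1 : i (Taft.h hq') ≠ 1 := fun e =>
    Taft.h_ne_one hq' hn (hi (by rw [e, map_one]))
  have hh1 : j (Taft.h hq) ≠ 1 := fun e =>
    Taft.h_ne_one hq hm (hj (by rw [e, map_one]))
  have hXe : ∀ e : k, i (Taft.x hq') ≠ e • (i (Taft.h hq') - 1) := fun e he =>
    Taft.x_ne_smul hq' hn e (hi (by rw [he, map_smul, map_sub, map_one]))
  have hxe : ∀ e : k, j (Taft.x hq) ≠ e • (j (Taft.h hq) - 1) := fun e he =>
    Taft.x_ne_smul hq hm e (hj (by rw [he, map_smul, map_sub, map_one]))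
  have hX0 : i (Taft.x hq') ≠ 0 := by simpa using hXe 0
  have hx0 : j (Taft.x hq) ≠ 0 := by simpa using hxe 0
  have hpow : j (Taft.h hq) ^ m = 1 := by rw [← map_pow, Taft.h_pow, map_one]
  have Hpow : i (Taft.h hq') ^ n = 1 := by rw [← map_pow, Taft.h_pow, map_one]
  have xpow : j (Taft.x hq) ^ m = 0 := by rw [← map_pow, Taft.x_pow, map_zero]
  have Xpow : i (Taft.x hq') ^ n = 0 := by rw [← map_pow, Taft.x_pow, map_zero]
  have xh : j (Taft.x hq) * j (Taft.h hq) = q • (j (Taft.h hq) * j (Taft.x hq)) := by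
    rw [← map_mul, Taft.x_mul_h, map_smul, map_mul]
  have XH : i (Taft.x hq') * i (Taft.h hq') = q' • (i (Taft.h hq') * i (Taft.x hq')) := by
    rw [← map_mul, Taft.x_mul_h, map_smul, map_mul]
  have ch : Coalgebra.comul (R := k) (j (Taft.h hq)) = j (Taft.h hq) ⊗ₜ j (Taft.h hq) := by
    rw [← CoalgHomClass.map_comp_comul_apply, Taft.comul_h]; rfl
  have cH : Coalgebra.comul (R := k) (i (Taft.h hq')) = i (Taft.h hq') ⊗ₜ i (Taft.h hq') := by
    rw [← CoalgHomClass.map_comp_comul_apply, Taft.comul_h]; rfl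
  have cx : Coalgebra.comul (R := k) (j (Taft.x hq)) =
      j (Taft.x hq) ⊗ₜ j (Taft.h hq) + 1 ⊗ₜ j (Taft.x hq) := by
    rw [← CoalgHomClass.map_comp_comul_apply, Taft.comul_x, map_add]
    rw [← map_one j]; rfl
  have cX : Coalgebra.comul (R := k) (i (Taft.x hq')) =
      i (Taft.x hq') ⊗ₜ i (Taft.h hq') + 1 ⊗ₜ i (Taft.x hq') := by
    rw [← CoalgHomClass.map_comp_comul_apply, Taft.comul_x, map_add]
    rw [← map_one i]; rfl
  have εh : Coalgebra.counit (R := k) (j (Taft.h hq)) = 1 := by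
    rw [CoalgHomClass.counit_comp_apply, Taft.counit_h]
  have εH : Coalgebra.counit (R := k) (i (Taft.h hq')) = 1 := by
    rw [CoalgHomClass.counit_comp_apply, Taft.counit_h]
  have hq1 : q ≠ 1 := hq.ne_one (by have := NeZero.ne m; omega)
  have hq1' : q' ≠ 1 := hq'.ne_one (by have := NeZero.ne n; omega)
  have nz : ∀ {g : E}, Coalgebra.counit (R := k) g = 1 → g ≠ 0 := by
    rintro g hg rfl
    simp at hg
  clear hΨi hΨj hΨ1 hi hj hΨ Ψ
  generalize j (Taft.h hq) = h at *
  generalize j (Taft.x hq) = x at *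
  generalize i (Taft.h hq') = H at *
  generalize i (Taft.x hq') = X at *
  clear i j
  have hh' := TwoTaft.mul_pow_pred hpow
  have h'h := TwoTaft.pow_pred_mul hpow
  have HH' := TwoTaft.mul_pow_pred Hpow
  have H'H := TwoTaft.pow_pred_mul Hpow
  have ch' : Coalgebra.comul (R := k) (h ^ (m - 1)) =
      (h ^ (m - 1)) ⊗ₜ (h ^ (m - 1)) := by
    rw [Bialgebra.comul_pow, ch, Algebra.TensorProduct.tmul_pow]
  have cH' : Coalgebra.comul (R := k) (H ^ (n - 1)) =
      (H ^ (n - 1)) ⊗ₜ (H ^ (n - 1)) := by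
    rw [Bialgebra.comul_pow, cH, Algebra.TensorProduct.tmul_pow]
  have chH' : ∀ {u : E}, u = h * H * h ^ (m - 1) → u * h = h * H := by
    rintro u rfl
    rw [mul_assoc, h'h, mul_one]
  have cy := comul_conj hh' ch ch' cX
  have cg : Coalgebra.comul (R := k) (h * H * h ^ (m - 1)) =
      (h * H * h ^ (m - 1)) ⊗ₜ (h * H * h ^ (m - 1)) := by simp [ch, ch', cH]
  have conj_back : ∀ u : E, h ^ (m - 1) * (h * u * h ^ (m - 1)) * h = u := by
    intro u
    rw [← mul_assoc, ← mul_assoc, h'h, one_mul, mul_assoc, h'h, mul_one]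
  have hg1 : h * H * h ^ (m - 1) ≠ 1 := by
    intro e
    have := conj_back H
    rw [e, mul_one, h'h] at this
    exact hH1 this.symm
  -- The skew primitive hXh⁻¹ has group-like hHh⁻¹. A nonzero x-coefficient would give hHh⁻¹ = h, so
  -- H = h; a zero X-coefficient would make X a multiple of H - 1. What remains forces hH = Hh.
  obtain ⟨σ, d, e, hy, hc, hd⟩ := skew cg (nz (by simp [εh, εH])) hg1 cy
  have hd0 : d = 0 := by
    by_contra hd0
    have := conj_back H
    rw [hd hd0, h'h, one_mul] at this
    exact hHh this.symm
  have hσ0 : σ ≠ 0 := by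
    rintro rfl
    have e1 := conj_back X
    rw [hy, hd0, zero_smul, zero_smul, zero_add, zero_add, mul_smul_comm, smul_mul_assoc, mul_sub,
      sub_mul, conj_back, mul_one, h'h] at e1
    exact hXe e e1.symm
  have hgH := hc hσ0
  have hH : h * H = H * h := (chH' hgH.symm).symm
  rw [hgH, hd0, zero_smul, add_zero] at hy
  have h'_comm : h ^ (m - 1) * H = H * h ^ (m - 1) := (show Commute h H from hH).pow_left _
  have hX : h * X = σ • (X * h) := conj_eq_smul_of_qcomm h'h HH' hH h'_comm hq1' XH hy
  have H'h : H ^ (n - 1) * h = h * H ^ (n - 1) := (show Commute H h from hH.symm).pow_left _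
  -- Conjugation by H⁻¹ instead of H, so that its scalar is exactly the τ in xH = τHx.
  have cy' := comul_conj H'H cH' cH cx
  rw [H'h, mul_assoc h, H'H, mul_one] at cy'
  obtain ⟨c, τ, e', hy', hc', -⟩ := skew ch (nz εh) hh1 cy'
  have hc0 : c = 0 := by
    by_contra hc0
    exact hHh (hc' hc0).symm
  rw [hc0, zero_smul, zero_add] at hy'
  have hτ := conj_eq_smul_of_qcomm HH' hh' H'h hH.symm hq1 xh hy'
  have hxH : x * H = τ • (H * x) := by
    calc x * H = H * (H ^ (n - 1) * x) * H := by rw [← mul_assoc, HH', one_mul]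
      _ = τ • (H * x) := by
        rw [hτ, mul_smul_comm, smul_mul_assoc, mul_assoc, mul_assoc, H'H, mul_one]
  -- The terms in x ⊗ hX and Xh ⊗ x type positions reduce to a single cross term X ⊗ Hx, whose
  -- coefficient τ - σ is the only obstruction to skew primitivity.
  have cz : Coalgebra.comul (R := k) (x * X - σ • (X * x)) =
      (x * X - σ • (X * x)) ⊗ₜ (H * h) + 1 ⊗ₜ (x * X - σ • (X * x)) +
        (τ - σ) • (X ⊗ₜ[k] (H * x)) := by
    simp only [map_sub, map_smul, Bialgebra.comul_mul, cx, cX, mul_add, add_mul,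
      Algebra.TensorProduct.tmul_mul_tmul, one_mul, mul_one, hH, hX, hxH,
      TensorProduct.tmul_smul, TensorProduct.sub_tmul, TensorProduct.tmul_sub,
      ← TensorProduct.smul_tmul']
    module
  have cHh : Coalgebra.comul (R := k) (H * h) = (H * h) ⊗ₜ (H * h) := by simp [cH, ch]
  have hHh0 : H * h ≠ 0 := nz (by simp [εh, εH])
  have hτσ := cross cHh hHh0 cz
  rw [hτσ, zero_smul, add_zero] at cz
  obtain rfl : τ = σ := sub_eq_zero.1 hτσ
  -- The group-like is now Hh, which is neither H nor h, so only the multiple of Hh - 1 survives.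
  obtain ⟨c, d, α, hz, hc, hd⟩ := skew cHh hHh0 hHh1 cz
  have hc0 : c = 0 := by
    by_contra hc0
    have := congrArg (H ^ (n - 1) * ·) (hc hc0)
    simp only [← mul_assoc, H'H, one_mul] at this
    exact hh1 this
  have hd0 : d = 0 := by
    by_contra hd0
    have := congrArg (· * h ^ (m - 1)) (hd hd0)
    simp only [mul_assoc, hh', mul_one] at this
    exact hH1 this
  rw [hc0, hd0, zero_smul, zero_smul, zero_add, zero_add, ← neg_sub 1 (H * h), smul_neg,
    ← neg_smul] at hz
  have hne : 1 - H * h ≠ 0 := sub_ne_zero.2 hHh1.symm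
  refine ⟨τ, -α, ?_, ?_, ?_, hpow, Hpow, xpow, Xpow, xh, XH, hxH, hX, hz, hH⟩
  · have := pow_mul_of_qcomm hX m
    rw [hpow, one_mul, mul_one, ← sub_eq_zero, ← one_smul k X, smul_smul, ← sub_smul,
      mul_one] at this
    exact (sub_eq_zero.1 ((smul_eq_zero.1 this).resolve_right hX0)).symm
  · have := mul_pow_of_qcomm hxH n
    rw [Hpow, one_mul, mul_one, ← sub_eq_zero, ← one_smul k x, smul_smul, ← sub_smul,
      mul_one] at this
    exact (sub_eq_zero.1 ((smul_eq_zero.1 this).resolve_right hx0)).symm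
  · refine or_iff_not_imp_left.2 fun hα => ?_
    -- The element xX - τXx is a nonzero multiple of 1 - Hh, which commutes with h and H. Moving it
    -- past h and past H using the other relations produces the scalars q/τ and q'τ, so both equal
    -- 1.
    have hcancel : ∀ (c : k) (u u' : E), u * u' = 1 → c • ((-α • (1 - H * h)) * u) = 0 → c = 0 := by
      intro c u u' hu hc
      have e1 := congrArg (· * u') hc
      simp only [smul_mul_assoc, mul_assoc, hu, mul_one, zero_mul] at e1
      exact (smul_eq_zero.1 e1).resolve_right (smul_ne_zero hα hne)
    have hστ : q - τ = 0 := by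
      refine hcancel _ h _ hh' ?_
      have e1 : q • (h * (x * X - τ • (X * x))) = τ • ((x * X - τ • (X * x)) * h) := by
        have e2 : q • (h * x * X) = τ • (x * X * h) := by
          rw [← smul_mul_assoc, ← xh, mul_assoc, hX, mul_smul_comm, mul_assoc]
        have e3 : q • (h * X * x) = τ • (X * x * h) := by
          rw [hX, smul_mul_assoc, mul_assoc, mul_assoc, xh, mul_smul_comm, smul_comm]
        rw [mul_sub, sub_mul, smul_sub, smul_sub, ← mul_assoc, e2, mul_smul_comm, smul_comm q τ,
          ← mul_assoc, e3, smul_mul_assoc]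
      have e4 : h * (-α • (1 - H * h)) = (-α • (1 - H * h)) * h := by
        rw [mul_smul_comm, smul_mul_assoc, mul_sub, sub_mul, ← mul_assoc, hH, mul_one, one_mul]
      rw [hz, e4] at e1
      rw [sub_smul, e1, sub_self]
    have hqτ : 1 - q' * τ = 0 := by
      refine hcancel _ H _ HH' ?_
      have e1 : (x * X - τ • (X * x)) * H = (q' * τ) • (H * (x * X - τ • (X * x))) := by
        have e2 : x * X * H = (q' * τ) • (H * (x * X)) := by
          rw [mul_assoc, XH, mul_smul_comm, ← mul_assoc, hxH, smul_mul_assoc, smul_smul, mul_assoc]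
        have e3 : X * x * H = (q' * τ) • (H * (X * x)) := by
          rw [mul_assoc, hxH, mul_smul_comm, ← mul_assoc, XH, smul_mul_assoc, smul_smul, mul_assoc,
            mul_comm τ]
        rw [sub_mul, mul_sub, smul_sub, e2, smul_mul_assoc, e3, mul_smul_comm,
          smul_comm τ (q' * τ)]
      have e4 : H * (-α • (1 - H * h)) = (-α • (1 - H * h)) * H := by
        rw [mul_smul_comm, smul_mul_assoc, mul_sub, sub_mul, mul_assoc H h, hH, mul_one, one_mul]
      rw [hz, e4] at e1
      rw [sub_smul, one_smul, ← e1, sub_self]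
    have h1 : q = τ := sub_eq_zero.1 hστ
    have h2 : q' * q = 1 := by rw [h1, ← sub_eq_zero, ← neg_sub, hqτ, neg_zero]
    refine ⟨?_, h1.symm, h2⟩
    -- q' is the inverse of q, so they have the same order, whence m = n.
    have h3 := hq.inv
    rw [← eq_inv_of_mul_eq_one_left h2] at h3
    exact h3.unique hq'

/-- The bijective multiplication map of E is the one of `TwoTaft` followed by the induced map f. As
the former map into `TwoTaft` is onto, f is bijective; no dimension count is needed. -/
theorem exists_bialgEquiv_of_factorsThrough [CharZero k] (hm : m ≠ 1) (hn : n ≠ 1)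
    (hE : FactorsThrough k (Taft hq') (Taft hq) E) :
    ∃ σ α : k, σ ^ m = 1 ∧ σ ^ n = 1 ∧ (α = 0 ∨ (m = n ∧ σ = q ∧ q' * q = 1)) ∧
      Nonempty (E ≃ₐc[k] TwoTaft hq' hq σ α) := by
  obtain ⟨i, j, hi, hj, hb⟩ := hE
  obtain ⟨Ψ, hΨ⟩ := FactorsThrough.exists_coalgEquiv i j hb
  obtain ⟨σ, α, hσm, hσn, hα, w⟩ := exists_relations_of_coalgEquiv hq hq' hm hn i j Ψ hΨ hi hj
  refine ⟨σ, α, hσm, hσn, hα, ?_⟩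
  obtain ⟨f, fh, fx, fH, fX⟩ := TwoTaft.exists_bialgHom hq' hq σ α w
    (by rw [← CoalgHomClass.map_comp_comul_apply, Taft.comul_h]; rfl)
    (by rw [← CoalgHomClass.map_comp_comul_apply, Taft.comul_x, map_add, ← map_one j]; rfl)
    (by rw [← CoalgHomClass.map_comp_comul_apply, Taft.comul_h]; rfl)
    (by rw [← CoalgHomClass.map_comp_comul_apply, Taft.comul_x, map_add, ← map_one i]; rfl)
    (by rw [CoalgHomClass.counit_comp_apply, Taft.counit_h])
    (by rw [CoalgHomClass.counit_comp_apply, Taft.counit_x])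
    (by rw [CoalgHomClass.counit_comp_apply, Taft.counit_h])
    (by rw [CoalgHomClass.counit_comp_apply, Taft.counit_x])
  have wT := TwoTaft.relations hq' hq σ α
  let iT := Taft.lift hq' _ _ wT.H_pow wT.X_pow wT.X_mul_H
  let jT := Taft.lift hq _ _ wT.h_pow wT.x_pow wT.x_mul_h
  have hs := TwoTaft.mul_map_surjective hq' hq σ α iT jT (Taft.lift_h _ _ _ _ _ _)
    (Taft.lift_x _ _ _ _ _ _) (Taft.lift_h _ _ _ _ _ _) (Taft.lift_x _ _ _ _ _ _)
  have fi : ∀ a, f (iT a) = i a := by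
    have : (f : _ →ₐ[k] E).comp iT = (i : _ →ₐ[k] E) := by
      apply Taft.algHom_ext <;> simp [iT, fH, fX]
    exact fun a => DFunLike.congr_fun this a
  have fj : ∀ l, f (jT l) = j l := by
    have : (f : _ →ₐ[k] E).comp jT = (j : _ →ₐ[k] E) := by
      apply Taft.algHom_ext <;> simp [jT, fh, fx]
    exact fun a => DFunLike.congr_fun this a
  have hcomp : ⇑(LinearMap.mul' k E ∘ₗ
      TensorProduct.map (i : Taft hq' →ₗ[k] E) (j : Taft hq →ₗ[k] E)) =
      f ∘ (LinearMap.mul' k _ ∘ₗ TensorProduct.map iT.toLinearMap jT.toLinearMap) := by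
    funext t
    induction t using TensorProduct.induction_on with
    | zero => simp
    | add s t hs ht => rw [map_add, hs, ht]; simp
    | tmul a l => simp [fi, fj]
  rw [hcomp] at hb
  exact ⟨(BialgEquiv.ofBijective f ⟨hb.1.of_comp_right hs, hb.2.of_comp⟩).symm⟩

end Forward

end TaftBicrossed

/-! ### The classification. -/

theorem mainTheorem2 {k : Type*} [Field k] [CharZero k] {m n : ℕ} [NeZero m] [NeZero n]
    (hm : m ≠ 1) (hn : n ≠ 1) {q q' : k} (hq : IsPrimitiveRoot q m) (hq' : IsPrimitiveRoot q' n)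
    {E : Type*} [Ring E] [HopfAlgebra k E] :
    (m ≠ n ∨ q' ≠ q ^ (n - 1) →
      (TaftBicrossed.FactorsThrough k (TaftBicrossed.Taft hq') (TaftBicrossed.Taft hq) E ↔
        ∃ σ : k, σ ^ Nat.gcd m n = 1 ∧
          Nonempty (E ≃ₐc[k] TaftBicrossed.TaftSigma hq' hq σ))) ∧
    (∀ hmn : m = n, q' = q ^ (n - 1) →
      (TaftBicrossed.FactorsThrough k (TaftBicrossed.Taft hq') (TaftBicrossed.Taft hq) E ↔
        (∃ σ : k, σ ^ n = 1 ∧ Nonempty (E ≃ₐc[k] TaftBicrossed.TaftSigma hq' hq σ)) ∨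
        (∃ α : k, α ≠ 0 ∧ Nonempty (E ≃ₐc[k] TaftBicrossed.TaftQ (show IsPrimitiveRoot q n from hmn ▸ hq) α)))) := by
  refine ⟨fun hne => ⟨fun hE => ?_, ?_⟩, ?_⟩
  · obtain ⟨σ, α, hσm, hσn, hα, e⟩ :=
      TaftBicrossed.exists_bialgEquiv_of_factorsThrough hq hq' hm hn hE
    rcases hα with rfl | ⟨rfl, -, hqq⟩
    · exact ⟨σ, pow_gcd_eq_one.2 ⟨hσm, hσn⟩, e⟩
    · rcases hne with h | h
      · exact absurd rfl h
      · refine absurd ?_ h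
        -- A nonzero α needs q'q = 1, that is q' = q^(m-1), which this case excludes.
        rw [← one_mul (q ^ (m - 1)), ← hqq, mul_assoc, TaftBicrossed.TwoTaft.mul_pow_pred
          hq.pow_eq_one, mul_one]
  · rintro ⟨σ, hσ, ⟨e⟩⟩
    refine (TaftBicrossed.TwoTaft.factorsThrough hq' hq σ 0 hm hn ?_ ?_ (Or.inl rfl)).of_bialgEquiv e
    · exact (pow_gcd_eq_one.1 hσ).1
    · exact (pow_gcd_eq_one.1 hσ).2
  · rintro rfl rfl
    refine ⟨fun hE => ?_, ?_⟩
    · obtain ⟨σ, α, hσm, hσn, hα, e⟩ :=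
        TaftBicrossed.exists_bialgEquiv_of_factorsThrough hq hq' hm hn hE
      by_cases h0 : α = 0
      · subst h0
        exact Or.inl ⟨σ, hσm, e⟩
      · obtain ⟨-, rfl, -⟩ := hα.resolve_left h0
        exact Or.inr ⟨α, h0, e⟩
    · rintro (⟨σ, hσ, ⟨e⟩⟩ | ⟨α, -, ⟨e⟩⟩)
      · exact (TaftBicrossed.TwoTaft.factorsThrough hq' hq σ 0 hm hn hσ hσ
          (Or.inl rfl)).of_bialgEquiv e
      · exact (TaftBicrossed.TwoTaft.factorsThrough hq' hq q α hm hn hq.pow_eq_one hq.pow_eq_one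
          (Or.inr ⟨rfl, rfl, TaftBicrossed.TwoTaft.pow_pred_mul hq.pow_eq_one⟩)).of_bialgEquiv e
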